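/- Fix $N$ and let $\mathcal C=C([-1,0],\mathbb R^N)$ with the uniform topology. $\mathcal{LC}$ denotes the set of Borel measurable $f:\mathbb R\times\mathbb R^{2N}\to\mathbb R^N$, $(t,x,y)\mapsto f(t,x,y)$, such that for every compact $K\subset\mathbb R^{2N}$ there are $m^K,l^K\in L^1_{loc}(\mathbb R)$ with, for a.e. $t$, $|f(t,z)|\le m^K(t)$ and $|f(t,z)-f(t,w)|\le l^K(t)|z-w|$ for all $z,w\in K$ (functions that agree almost everywhere are identified). For $j\in\mathbb N$ let $B_j\subset\mathbb R^{2N}$ be the closed Euclidean ball of radius $j$ centred at $0$; an $m$-bound of $f$ on $B_j$ is an $m\in L^1_{loc}$ with $|f(t,z)|\le m(t)$ for a.e. $t$ and all $z\in B_j$, and $m_f^j(t)=\sup_{z\in B_j}|f(t,z)|$ is the optimal one. Write $f_s(t,x,y)=f(s+t,x,y)$. For $f\in\mathcal{LC}$ and $\phi\in\mathcal C$, $x(\cdot,f,\phi)$ is the unique maximal Carathéodory solution, defined on $I_{f,\phi}=[-1,b_{f,\phi})$, of $x'(t)=f(t,x(t),x(t-1))$ for $t>0$, $x=\phi$ on $[-1,0]$;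 for $0\le t\in I_{f,\phi}$, $x_t(\cdot,f,\phi)\in\mathcal C$ is $s\mapsto x(t+s,f,\phi)$. Let $E\subset\mathcal{LC}$ have $L^1_{loc}$-equicontinuous $m$-bounds: for every $j$ there is a set $S^j$ of nonnegative functions in $L^1_{loc}$ that contains an $m$-bound on $B_j$ of each $f\in E$, and such that for all $r,\varepsilon>0$ there is $\delta>0$ with $\int_s^t m<\varepsilon$ for all $m\in S^j$ and all $-r\le s\le t\le r$ with $t-s<\delta$. Assume that every $f\in E$ satisfies $(K_y)$: for all $a,b,c\in\mathbb R^N$ with $b\le c$ componentwise and all $k$, $f_k(t,a,b)\le f_k(t,a,c)$ for a.e. $t$. For rational $q_1<q_2$, $I=[q_1,q_2]$, $j\in\mathbb N$, $s\ge 0$ let $\theta^I_j(s)=\sup_{t\in I,\,f\in E}\int_t^{t+s}m_f^j(u)\,du$, let $\Theta=\{\theta^I_j\}$ be the moduli given by the $m$-bounds of $E$, and let $\mathcal K^I_j$ be the set of continuous $x:I\to\mathbb R^N$ with $|x|\le j$ and $|x(t)-x(s)|\le\theta^I_j(|t-s|)$ on $I$. Let $D\subset\mathbb R^N$ be countable and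 dense. The topologies $\sigma_{\Theta D}$ and $\mathcal T_{\Theta D}$ on $\mathcal{LC}$ are those generated by the seminorms $$\sup_{x\in\mathcal K^I_j}\Big|\int_I f(t,x(t),y)\,dt\Big|\qquad\text{and}\qquad \sup_{x\in\mathcal K^I_j}\int_I |f(t,x(t),y)|\,dt$$ respectively, over all $I,j$ as above and $y\in D$. Then: (i) If $\phi_n\to\phi$ uniformly in $\mathcal C$, $f_n\in E$, $f\in\mathcal{LC}$ and $f_n\to f$ in $\sigma_{\Theta D}$, then for every $[-1,T]\subset I_{f,\phi}$ one has $[-1,T]\subset I_{f_n,\phi_n}$ for all large $n$, and $x(\cdot,f_n,\phi_n)\to x(\cdot,f,\phi)$ uniformly on $[-1,T]$. (ii) Suppose in addition that $f_s\in E$ for all $f\in E$, $s\in\mathbb R$. Let $\mathcal T\in\{\sigma_{\Theta D},\mathcal T_{\Theta D}\}$, let $\overline E$ be the closure of $E$ in $(\mathcal{LC},\mathcal T)$ with the topology induced by $\mathcal T$, and $\mathcal U=\{(t,f,\phi)\mid f\in\overline E,\ \phi\in\mathcal C,\ 0\le t\in I_{f,\phi}\}$. Then $$\Phi:\mathcal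 U\subset[0,\infty)\times\overline E\times\mathcal C\to\overline E\times\mathcal C,\qquad (t,f,\phi)\mapsto\big(f_t,x_t(\cdot,f,\phi)\big)$$ is a continuous (local) skew-product semiflow: $\overline E$ is invariant under all translations and $(t,f)\mapsto f_t$ is continuous on $\mathbb R\times\overline E$; $\mathcal U$ is relatively open in $[0,\infty)\times\overline E\times\mathcal C$ and contains every $(0,f,\phi)$; $\Phi$ is continuous on $\mathcal U$ with values in $\overline E\times\mathcal C$; $\Phi(0,f,\phi)=(f,\phi)$; and for $s,t\ge0$, $(s+t,f,\phi)\in\mathcal U$ if and only if $(s,f,\phi)\in\mathcal U$ and $(t,\Phi(s,f,\phi))\in\mathcal U$, in which case $\Phi(s+t,f,\phi)=\Phi(t,\Phi(s,f,\phi))$. -/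

import Mathlib

open Set Filter Topology MeasureTheory
open scoped ENNReal

noncomputable section

namespace CarDelay

/-- `ℝ^N` with the Euclidean norm. -/
abbrev V (N : ℕ) : Type := EuclideanSpace ℝ (Fin N)

/-- The phase space `C([-1,0], ℝ^N)` with the topology of uniform convergence. -/
abbrev Hist (N : ℕ) : Type := C(Icc (-1 : ℝ) 0, V N)

/-- Lipschitz Carathéodory functions `f : ℝ × ℝ^{2N} → ℝ^N`, with `ℝ^{2N}` written as
`ℝ^N × ℝ^N`.  These are honest functions; two of them that agree almost everywhere are
topologically indistinguishable for the topologies below, which implements the usual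
identification of such functions. -/
@[ext]
structure LC (N : ℕ) where
  /-- the underlying function `(t, x, y) ↦ f t x y` -/
  toFun : ℝ → V N → V N → V N
  measurable' : Measurable fun p : ℝ × V N × V N => toFun p.1 p.2.1 p.2.2
  mbound' : ∀ K : Set (V N × V N), IsCompact K → ∃ m : ℝ → ℝ, LocallyIntegrable m volume ∧
    ∀ᵐ t : ℝ, ∀ z ∈ K, ‖toFun t z.1 z.2‖ ≤ m t
  lipschitz' : ∀ K : Set (V N × V N), IsCompact K → ∃ l : ℝ → ℝ, LocallyIntegrable l volume ∧
    ∀ᵐ t : ℝ, ∀ z ∈ K, ∀ w ∈ K, ‖toFun t z.1 z.2 - toFun t w.1 w.2‖ ≤ l t * ‖z - w‖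

variable {N : ℕ}

instance : CoeFun (LC N) (fun _ => ℝ → V N → V N → V N) := ⟨LC.toFun⟩

theorem locallyIntegrable_translate {m : ℝ → ℝ} (hm : LocallyIntegrable m volume) (s : ℝ) :
    LocallyIntegrable (fun t => m (s + t)) volume := by
  rw [locallyIntegrable_iff] at hm ⊢
  intro K hK
  have e : MeasurableEmbedding (fun t : ℝ => s + t) := measurableEmbedding_addLeft s
  have mp : MeasurePreserving (fun t : ℝ => s + t) volume volume :=
    measurePreserving_add_left volume s
  have h := (mp.integrableOn_image e (f := m) (s := K)).1
    (hm _ (hK.image (by fun_prop)))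
  exact h

theorem ae_translate {P : ℝ → Prop} (hP : ∀ᵐ t : ℝ, P t) (s : ℝ) : ∀ᵐ t : ℝ, P (s + t) :=
  (measurePreserving_add_left (volume : Measure ℝ) s).quasiMeasurePreserving.ae hP

/-- The time translation `f_s(t, x, y) = f(s + t, x, y)`. -/
def translate (s : ℝ) (f : LC N) : LC N where
  toFun t x y := f (s + t) x y
  measurable' := by
    have h : Measurable fun p : ℝ × V N × V N => ((s + p.1, p.2.1, p.2.2) : ℝ × V N × V N) := by
      fun_prop
    exact f.measurable'.comp h
  mbound' K hK := by
    obtain ⟨m, hm, h⟩ := f.mbound' K hK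
    exact ⟨_, locallyIntegrable_translate hm s, ae_translate h s⟩
  lipschitz' K hK := by
    obtain ⟨l, hl, h⟩ := f.lipschitz' K hK
    exact ⟨_, locallyIntegrable_translate hl s, ae_translate h s⟩

/-- The closed Euclidean ball of `ℝ^{2N}` of radius `j` centred at the origin. -/
def ball2 (N j : ℕ) : Set (V N × V N) := {z | ‖z.1‖ ^ 2 + ‖z.2‖ ^ 2 ≤ (j : ℝ) ^ 2}

/-- The delay monotonicity `(K_y)`. -/
def Ky (f : LC N) : Prop :=
  ∀ a b c : V N, (∀ i, b i ≤ c i) → ∀ k, ∀ᵐ t : ℝ, f t a b k ≤ f t a c k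

/-! ### `m`-bounds and the moduli of continuity that they define -/

/-- `m` is an `m`-bound of `f` on the ball of radius `j`. -/
def IsMBound (f : LC N) (j : ℕ) (m : ℝ → ℝ) : Prop :=
  LocallyIntegrable m volume ∧ ∀ᵐ t : ℝ, ∀ z ∈ ball2 N j, ‖f t z.1 z.2‖ ≤ m t

/-- `L¹_loc`-equicontinuity of a set of nonnegative locally integrable functions. -/
def L1LocEquicontinuous (S : Set (ℝ → ℝ)) : Prop :=
  (∀ m ∈ S, LocallyIntegrable m volume ∧ ∀ᵐ t : ℝ, 0 ≤ m t) ∧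
    ∀ r > (0 : ℝ), ∀ ε > (0 : ℝ), ∃ δ > (0 : ℝ), ∀ s t : ℝ, -r ≤ s → s ≤ t → t ≤ r → t - s < δ →
      ∀ m ∈ S, ∫ u in s..t, m u < ε

/-- `E` has `L¹_loc`-equicontinuous `m`-bounds. -/
def HasL1LocEquicontinuousMBounds (E : Set (LC N)) : Prop :=
  ∀ j : ℕ, ∃ S : Set (ℝ → ℝ), (∀ f ∈ E, ∃ m ∈ S, IsMBound f j m) ∧ L1LocEquicontinuous S

/-- The optimal `m`-bound of `f` on the ball of radius `j`, with values in `[0, ∞]`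
(it is finite for almost every `t`). -/
def optMBound (f : LC N) (j : ℕ) (t : ℝ) : ℝ≥0∞ := ⨆ z ∈ ball2 N j, ‖f t z.1 z.2‖ₑ

/-- A family of moduli of continuity `θ^I_j(s)`, indexed by the endpoints of the rational interval
`I = [q₁, q₂]`, by `j`, and by `s ≥ 0`. -/
abbrev Moduli : Type := ℚ → ℚ → ℕ → ℝ → ℝ≥0∞

/-- The moduli of continuity given by the `m`-bounds of `E`:
`θ^I_j(s) = sup_{t ∈ I, f ∈ E} ∫_t^{t+s} m_f^j(u) du`. The values are finite as soon as `E` has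
`L¹_loc`-equicontinuous `m`-bounds. -/
def mBoundModuli (E : Set (LC N)) : Moduli := fun q₁ q₂ j s =>
  ⨆ t ∈ Icc (q₁ : ℝ) q₂, ⨆ f ∈ E, ∫⁻ u in Icc t (t + s), optMBound f j u

/-! ### The hybrid topologies -/

/-- The set `K^I_j`, `I = [q₁, q₂]`: continuous functions on `I` that are bounded by `j` and admit
`θ^I_j` as a modulus of continuity. (Only the restriction of `x` to `I` is ever used.) -/
def KSet (N : ℕ) (Θ : Moduli) (q₁ q₂ : ℚ) (j : ℕ) : Set (ℝ → V N) :=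
  {x | ContinuousOn x (Icc (q₁ : ℝ) q₂) ∧ (∀ t ∈ Icc (q₁ : ℝ) q₂, ‖x t‖ ≤ j) ∧
    ∀ t ∈ Icc (q₁ : ℝ) q₂, ∀ s ∈ Icc (q₁ : ℝ) q₂, edist (x t) (x s) ≤ Θ q₁ q₂ j |t - s|}

/-- The index set of the seminorms: rational intervals `I = [q₁, q₂]`, points `y ∈ D`, and `j`. -/
abbrev Idx (D : Set (V N)) : Type := {q : ℚ × ℚ // q.1 < q.2} × D × ℕ

/-- `sup_{x ∈ K^I_j} |∫_I h(t, x(t), y) dt|`. -/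
def weakSeminorm (Θ : Moduli) (D : Set (V N)) (i : Idx D) (h : ℝ → V N → V N → V N) : ℝ≥0∞ :=
  ⨆ x ∈ KSet N Θ i.1.1.1 i.1.1.2 i.2.2,
    ‖∫ t in Icc (i.1.1.1 : ℝ) i.1.1.2, h t (x t) i.2.1‖ₑ

/-- `sup_{x ∈ K^I_j} ∫_I |h(t, x(t), y)| dt`. -/
def strongSeminorm (Θ : Moduli) (D : Set (V N)) (i : Idx D) (h : ℝ → V N → V N → V N) : ℝ≥0∞ :=
  ⨆ x ∈ KSet N Θ i.1.1.1 i.1.1.2 i.2.2,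
    ∫⁻ t in Icc (i.1.1.1 : ℝ) i.1.1.2, ‖h t (x t) i.2.1‖ₑ

/-- The topology on `LC` generated by a family `p` of seminorms: the coarsest one for which all the
distance functions `g ↦ p i (g - f)`, `f ∈ LC`, are continuous. -/
@[reducible] def seminormTopology {ι : Type} (p : ι → (ℝ → V N → V N → V N) → ℝ≥0∞) :
    TopologicalSpace (LC N) :=
  ⨅ (i : ι) (f : LC N), TopologicalSpace.induced
    (fun g : LC N => p i (fun t x y => g t x y - f t x y)) inferInstance

/-- The weak hybrid topology `σ_{ΘD}` on `LC`. -/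
@[reducible] def sigmaTop (Θ : Moduli) (D : Set (V N)) : TopologicalSpace (LC N) :=
  seminormTopology (weakSeminorm Θ D)

/-- The strong hybrid topology `T_{ΘD}` on `LC`. -/
@[reducible] def strongTop (Θ : Moduli) (D : Set (V N)) : TopologicalSpace (LC N) :=
  seminormTopology (strongSeminorm Θ D)

/-! ### Solutions of the delay equation and the skew-product semiflow -/

/-- `x` is on `[-1, T]` a (Carathéodory) solution of `x'(t) = f(t, x(t), x(t-1))` for `t > 0`,
`x = φ` on `[-1, 0]`. -/
def IsSolutionOn (f : LC N) (φ : Hist N) (T : ℝ) (x : ℝ → V N) : Prop :=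
  ContinuousOn x (Icc (-1) T) ∧ (∀ s : Icc (-1 : ℝ) 0, x s = φ s) ∧
    ∀ t ∈ Icc 0 T, x t = φ ⟨0, by norm_num⟩ + ∫ s in 0..t, f s (x s) (x (s - 1))

/-- There is a solution on some `[-1, T]` with `T ≥ 0` and `T ≥ t`. -/
def ExistsUpTo (f : LC N) (φ : Hist N) (t : ℝ) : Prop :=
  ∃ x : ℝ → V N, ∃ T : ℝ, 0 ≤ T ∧ t ≤ T ∧ IsSolutionOn f φ T x

/-- The maximal interval of existence `I_{f,φ} = [-1, b_{f,φ})`. -/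
def maxInterval (f : LC N) (φ : Hist N) : Set ℝ := {t | -1 ≤ t ∧ ExistsUpTo f φ t}

open Classical in
/-- The solution `t ↦ x(t, f, φ)` on `I_{f,φ}` (solutions are unique, so the choice below does not
matter); the value off `I_{f,φ}` is irrelevant. -/
def sol (f : LC N) (φ : Hist N) (t : ℝ) : V N :=
  if h : ExistsUpTo f φ t then h.choose t else 0

open Classical in
/-- The history segment `x_t(s, f, φ) = x(t + s, f, φ)`, `s ∈ [-1, 0]`, for `0 ≤ t ∈ I_{f,φ}`
(the value for other `t` is irrelevant). -/
def segment (f : LC N) (φ : Hist N) (t : ℝ) : Hist N :=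
  if h : Continuous fun s : Icc (-1 : ℝ) 0 => sol f φ (t + s) then ⟨_, h⟩ else 0

/-- `E` is invariant with respect to the base flow `(s, f) ↦ f_s`. -/
def BaseInvariant (E : Set (LC N)) : Prop := ∀ f ∈ E, ∀ s : ℝ, translate s f ∈ E

/-- The domain `U = {(t, f, φ) | f ∈ A, φ ∈ C, t ∈ I_{f,φ}, t ≥ 0}`. -/
def semiflowDomain (A : Set (LC N)) : Set (ℝ × LC N × Hist N) :=
  {p | 0 ≤ p.1 ∧ p.2.1 ∈ A ∧ p.1 ∈ maxInterval p.2.1 p.2.2}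

/-- `Φ(t, f, φ) = (f_t, x_t(·, f, φ))`. -/
def skewMap (p : ℝ × LC N × Hist N) : LC N × Hist N :=
  (translate p.1 p.2.1, segment p.2.1 p.2.2 p.1)

/-- `Φ : U ⊆ ℝ⁺ × A × C → A × C`, `(t, f, φ) ↦ (f_t, x_t(·, f, φ))` is a (local) continuous
skew-product semiflow, `A` being endowed with the topology induced by `τ`: the translations are a
continuous flow on `A`; `U` is relatively open, contains all `(0, f, φ)`, and `Φ` takes values
in `A × C`, satisfies the identity and semigroup laws, and is continuous on `U`. -/
structure IsContinuousSkewProductSemiflow (τ : TopologicalSpace (LC N)) (A : Set (LC N)) :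
    Prop where
  base_invariant : BaseInvariant A
  base_continuous :
    ContinuousOn (fun q : ℝ × LC N => translate q.1 q.2) (univ ×ˢ A)
  mapsTo : MapsTo skewMap (semiflowDomain A) (A ×ˢ univ)
  zero : ∀ f ∈ A, ∀ φ : Hist N, (0, f, φ) ∈ semiflowDomain A ∧ skewMap (0, f, φ) = (f, φ)
  add : ∀ s t : ℝ, 0 ≤ s → 0 ≤ t → ∀ f ∈ A, ∀ φ : Hist N,
    ((s + t, f, φ) ∈ semiflowDomain A ↔
      (s, f, φ) ∈ semiflowDomain A ∧ (t, skewMap (s, f, φ)) ∈ semiflowDomain A) ∧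
    ((s + t, f, φ) ∈ semiflowDomain A → skewMap (s + t, f, φ) = skewMap (t, skewMap (s, f, φ)))
  isOpen_domain : ∃ O : Set (ℝ × LC N × Hist N), IsOpen O ∧
    semiflowDomain A = O ∩ (Ici 0 ×ˢ A ×ˢ univ)
  continuousOn : ContinuousOn skewMap (semiflowDomain A)

end CarDelay

end

/-!
The mechanism is the following. Equations in `E` have solutions whose modulus of continuity is
controlled by the `m`-bounds of `E`, so bounded solutions belong to the sets `K^I_j` over which the
seminorms are uniform (`IsSolutionOn.mem_KSet`). The seminorms only see constant values of the
delayed argument. Given a bounded solution `x` of the equation defined by `g ∈ E`, the time axis is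
divided into rational cells on which `x(t - 1)` oscillates so little that it lies between two nearby
points `d₁ ≤ d₂` of `D`. By `(K_y)` the components of `g(t, x(t), x(t - 1))` lie between those of
`g(t, x(t), d₁)` and `g(t, x(t), d₂)`, whose integrals are close to those of `f` as soon as finitely
many weak seminorms of `g - f` are small; the Lipschitz continuity of `f`, not of `g`, takes `d₁` and
`d₂` back to `x(t - 1)` (`Ky.norm_integral_sub_le`, `exists_eventually_norm_integral_sub_le`).
A Grönwall inequality with delay and with the integrable Lipschitz bound of `f` as its kernel
(`exists_delay_gronwall`) turns this into closeness of the solutions, up to the first exit time from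
a neighbourhood of the given solution. As a maximal solution can end only by blowing up
(`exists_lt_norm_sol`), the exit time is never reached: this is
`exists_eventually_norm_sol_sub_le`, which contains the first assertion.

For the semiflow, an equation in the closure of `E` is approximated by equations in `E` with the
same initial data, so that continuous dependence passes to the closure without any `m`-bound or
monotonicity of the limit (`exists_eventually_closure_norm_sol_sub_le`). If `E` is translation
invariant, the moduli `θ^I_j` do not depend on `I`; therefore translated test curves are test curves
on any other interval, and translating `g` and `f` simultaneously is controlled by a seminorm over a
slightly larger rational interval (`eventually_weakDist_translate_le`,
`eventually_strongDist_translate_le`). With the continuity of translations in `L¹_loc` for the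
single function `f` (`tendsto_strongDist_translate`) and the triangle inequality, the base flow is
continuous on the closure (`continuousOn_translate_closure`). The identity and semigroup laws follow
from uniqueness and concatenation of solutions (`IsSolutionOn.shift`, `IsSolutionOn.glue`).
-/

noncomputable section

namespace CarDelay

variable {N : ℕ}

/-! ### Bounds, continuity and integrability -/

theorem locallyIntegrable_intervalIntegrable {F : Type*} [NormedAddCommGroup F] {m : ℝ → F}
    (hm : LocallyIntegrable m volume) (a b : ℝ) : IntervalIntegrable m volume a b :=
  intervalIntegrable_iff.2 ((hm.integrableOn_isCompact isCompact_uIcc).mono_set uIoc_subset_uIcc)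

theorem LC.exists_mbound (f : LC N) (R : ℝ) : ∃ m : ℝ → ℝ, LocallyIntegrable m volume ∧
    (∀ t, 0 ≤ m t) ∧ ∀ᵐ t : ℝ, ∀ a b : V N, ‖a‖ ≤ R → ‖b‖ ≤ R → ‖f t a b‖ ≤ m t := by
  obtain ⟨m, hm, h⟩ := f.mbound' (Metric.closedBall 0 R) (isCompact_closedBall 0 R)
  refine ⟨fun t => |m t|, fun t => (hm t).norm, fun t => abs_nonneg _, ?_⟩
  filter_upwards [h] with t ht a b ha hb
  refine (ht (a, b) ?_).trans (le_abs_self _)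
  simp [Prod.norm_def, ha, hb]

theorem LC.exists_lipschitz (f : LC N) (R : ℝ) : ∃ l : ℝ → ℝ, LocallyIntegrable l volume ∧
    (∀ t, 0 ≤ l t) ∧ ∀ᵐ t : ℝ, ∀ a b a' b' : V N, ‖a‖ ≤ R → ‖b‖ ≤ R → ‖a'‖ ≤ R → ‖b'‖ ≤ R →
      ‖f t a b - f t a' b'‖ ≤ l t * (‖a - a'‖ + ‖b - b'‖) := by
  obtain ⟨l, hl, h⟩ := f.lipschitz' (Metric.closedBall 0 R) (isCompact_closedBall 0 R)
  refine ⟨fun t => |l t|, fun t => (hl t).norm, fun t => abs_nonneg _, ?_⟩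
  filter_upwards [h] with t ht a b a' b' ha hb ha' hb'
  refine (ht (a, b) (by simp [Prod.norm_def, ha, hb]) (a', b')
    (by simp [Prod.norm_def, ha', hb'])).trans ?_
  gcongr
  · exact le_abs_self _
  · simp only [Prod.norm_def, Prod.mk_sub_mk]
    exact max_le (by linarith [norm_nonneg (b - b')]) (by linarith [norm_nonneg (a - a')])

theorem LC.ae_continuous (f : LC N) : ∀ᵐ t : ℝ, Continuous fun z : V N × V N => f t z.1 z.2 := by
  choose l _ hl0 hl using fun n : ℕ => f.exists_lipschitz (n : ℝ)
  filter_upwards [ae_all_iff.2 hl] with t ht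
  refine continuous_iff_continuousAt.2 fun z => ?_
  obtain ⟨n, hn⟩ := exists_nat_gt ‖z‖
  rw [ContinuousAt, tendsto_iff_norm_sub_tendsto_zero]
  have h1 : Tendsto (fun w : V N × V N => l n t * (‖w.1 - z.1‖ + ‖w.2 - z.2‖)) (𝓝 z) (𝓝 0) := by
    have : Continuous fun w : V N × V N => l n t * (‖w.1 - z.1‖ + ‖w.2 - z.2‖) := by fun_prop
    simpa using this.tendsto z
  have h2 : ∀ᶠ w : V N × V N in 𝓝 z, ‖w‖ < n :=
    (continuous_norm.tendsto z).eventually_lt_const hn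
  refine squeeze_zero' (Eventually.of_forall fun _ => norm_nonneg _) ?_ h1
  filter_upwards [h2] with w hw
  exact ht n _ _ _ _ ((norm_fst_le w).trans hw.le) ((norm_snd_le w).trans hw.le)
    ((norm_fst_le z).trans hn.le) ((norm_snd_le z).trans hn.le)

theorem LC.measurable_comp (f : LC N) {x w : ℝ → V N} (hx : Measurable x) (hw : Measurable w) :
    Measurable fun t => f t (x t) (w t) :=
  f.measurable'.comp (measurable_id.prodMk (hx.prodMk hw))

/-- The integrand of the seminorms and of the integral equation is integrable, so that no Bochner
integral below takes its default value. -/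
theorem LC.integrableOn (f : LC N) {x w : ℝ → V N} {a b : ℝ} (hx : ContinuousOn x (Icc a b))
    (hw : ContinuousOn w (Icc a b)) : IntegrableOn (fun t => f t (x t) (w t)) (Icc a b) := by
  rcases lt_or_ge b a with hab | hab
  · simp [Icc_eq_empty_of_lt hab]
  let x' : ℝ → V N := IccExtend hab ((Icc a b).domRestrict x)
  let w' : ℝ → V N := IccExtend hab ((Icc a b).domRestrict w)
  have hx' : Continuous x' := (continuousOn_iff_continuous_domRestrict.1 hx).Icc_extend'
  have hw' : Continuous w' := (continuousOn_iff_continuous_domRestrict.1 hw).Icc_extend'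
  have ex : ∀ t ∈ Icc a b, x' t = x t := fun t ht => IccExtend_of_mem hab _ ht
  have ew : ∀ t ∈ Icc a b, w' t = w t := fun t ht => IccExtend_of_mem hab _ ht
  refine IntegrableOn.congr_fun (f := fun t => f t (x' t) (w' t)) ?_
    (fun t ht => by simp only [ex t ht, ew t ht]) measurableSet_Icc
  obtain ⟨Rx, hRx⟩ := (isCompact_Icc (a := a) (b := b)).exists_bound_of_continuousOn hx'.continuousOn
  obtain ⟨Rw, hRw⟩ := (isCompact_Icc (a := a) (b := b)).exists_bound_of_continuousOn hw'.continuousOn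
  obtain ⟨m, hm, hm0, hb⟩ := f.exists_mbound (max Rx Rw)
  refine Integrable.mono' (g := m) (hm.integrableOn_isCompact isCompact_Icc)
    (f.measurable_comp hx'.measurable hw'.measurable).aestronglyMeasurable ?_
  filter_upwards [ae_restrict_of_ae hb, ae_restrict_mem measurableSet_Icc] with t ht htm
  exact ht _ _ ((hRx t htm).trans (le_max_left _ _)) ((hRw t htm).trans (le_max_right _ _))

theorem LC.intervalIntegrable (f : LC N) {x w : ℝ → V N} {a b : ℝ} (hab : a ≤ b)
    (hx : ContinuousOn x (Icc a b)) (hw : ContinuousOn w (Icc a b)) :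
    IntervalIntegrable (fun t => f t (x t) (w t)) volume a b := by
  rw [intervalIntegrable_iff_integrableOn_Icc_of_le hab]
  exact f.integrableOn hx hw

theorem LC.locallyIntegrable_const (f : LC N) (a b : V N) :
    LocallyIntegrable (fun t => f t a b) volume := by
  refine (f.exists_mbound (max ‖a‖ ‖b‖)).elim fun m hm => hm.1.mono
    (f.measurable_comp measurable_const measurable_const).aestronglyMeasurable ?_
  filter_upwards [hm.2.2] with t ht
  exact (ht a b (le_max_left _ _) (le_max_right _ _)).trans (le_abs_self _)

/-- In `(K_y)` the null set may be chosen independently of the points. -/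
theorem Ky.ae {f : LC N} (h : Ky f) :
    ∀ᵐ t : ℝ, ∀ a b c : V N, (∀ i, b i ≤ c i) → ∀ k, f t a b k ≤ f t a c k := by
  let S : Set (V N × V N × V N) := {p | ∀ i, p.2.1 i ≤ p.2.2 i}
  obtain ⟨s, hsc, hsd⟩ := TopologicalSpace.exists_countable_dense S
  have h1 : ∀ᵐ t : ℝ, ∀ p ∈ s, ∀ k, f t p.1.1 p.1.2.1 k ≤ f t p.1.1 p.1.2.2 k :=
    (ae_ball_iff hsc).2 fun p _ => ae_all_iff.2 fun k => h _ _ _ p.2 k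
  filter_upwards [h1, f.ae_continuous] with t ht hc a b c hbc k
  have hcl : IsClosed {p : S | f t p.1.1 p.1.2.1 k ≤ f t p.1.1 p.1.2.2 k} := by
    refine isClosed_le ?_ ?_
    · have : Continuous fun p : S => f t p.1.1 p.1.2.1 :=
        hc.comp (f := fun p : S => (p.1.1, p.1.2.1)) (by fun_prop)
      fun_prop
    · have : Continuous fun p : S => f t p.1.1 p.1.2.2 :=
        hc.comp (f := fun p : S => (p.1.1, p.1.2.2)) (by fun_prop)
      fun_prop
  have : (univ : Set S) ⊆ {p : S | f t p.1.1 p.1.2.1 k ≤ f t p.1.1 p.1.2.2 k} := by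
    rw [← hsd.closure_eq]
    exact closure_minimal (fun p hp => ht p hp k) hcl
  exact this (mem_univ (⟨(a, b, c), hbc⟩ : S))

/-- The primitive of a locally integrable function is uniformly continuous on compact intervals. -/
theorem exists_integral_le_of_locallyIntegrable {m : ℝ → ℝ} (hm : LocallyIntegrable m volume)
    (a b : ℝ) {ε : ℝ} (hε : 0 < ε) : ∃ δ > (0 : ℝ), ∀ s t, a ≤ s → s ≤ t → t ≤ b → t - s ≤ δ →
      ∫ u in s..t, m u ≤ ε := by
  have hint : ∀ s t, IntervalIntegrable m volume s t := locallyIntegrable_intervalIntegrable hm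
  have hc : ContinuousOn (fun t => ∫ u in (0 : ℝ)..t, m u) (Icc a b) :=
    (intervalIntegral.continuous_primitive hint 0).continuousOn
  have huc := isCompact_Icc.uniformContinuousOn_of_continuous hc
  obtain ⟨δ, hδ, h⟩ := Metric.uniformContinuousOn_iff.1 huc ε hε
  refine ⟨δ / 2, by positivity, fun s t has hst htb hd => ?_⟩
  have := h t ⟨has.trans hst, htb⟩ s ⟨has, hst.trans htb⟩ (by
    rw [Real.dist_eq, abs_of_nonneg (by linarith)]; linarith)
  rw [Real.dist_eq, intervalIntegral.integral_interval_sub_left (hint _ _) (hint _ _)] at this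
  exact (le_abs_self _).trans this.le

/-! ### A Grönwall inequality with delay and with an integrable kernel -/

/-- A Grönwall inequality for the kernel `l ∈ L¹_loc` and the delay `1`. The constant is obtained
by steps whose length `δ ≤ 1` is such that `l` has integral at most `1/2` over each step. -/
theorem exists_delay_gronwall {l : ℝ → ℝ} (hl : LocallyIntegrable l volume) (hl0 : ∀ t, 0 ≤ l t)
    {T : ℝ} (hT : 0 ≤ T) : ∃ C > (0 : ℝ), ∀ (S a : ℝ) (u : ℝ → ℝ), S ≤ T → 0 ≤ a →
      ContinuousOn u (Icc (-1) S) → (∀ s ∈ Icc (-1) S, 0 ≤ u s) → (∀ s ∈ Icc (-1) 0, u s ≤ a) →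
      (∀ s ∈ Icc 0 S, u s ≤ a + ∫ r in 0..s, l r * (u r + u (r - 1))) →
      ∀ s ∈ Icc (-1) S, u s ≤ C * a := by
  obtain ⟨δ, hδ, hlδ⟩ := exists_integral_le_of_locallyIntegrable hl 0 T (ε := 1 / 2) (by norm_num)
  set η := min δ 1 with hη
  have hη0 : 0 < η := lt_min hδ one_pos
  have hli := locallyIntegrable_intervalIntegrable hl
  set L := ∫ r in 0..T, l r with hL
  have hL0 : 0 ≤ L := intervalIntegral.integral_nonneg hT fun t _ => hl0 t
  have key : ∀ k : ℕ, ∃ C > (0 : ℝ), ∀ (S a : ℝ) (u : ℝ → ℝ), S ≤ T → 0 ≤ a →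
      ContinuousOn u (Icc (-1) S) → (∀ s ∈ Icc (-1) S, 0 ≤ u s) → (∀ s ∈ Icc (-1) 0, u s ≤ a) →
      (∀ s ∈ Icc 0 S, u s ≤ a + ∫ r in 0..s, l r * (u r + u (r - 1))) →
      ∀ s ∈ Icc (-1) S, s ≤ k * η → u s ≤ C * a := by
    intro k
    induction k with
    | zero =>
      refine ⟨1, one_pos, fun S a u _ _ _ _ h0 _ s hs hs0 => ?_⟩
      rw [one_mul]
      exact h0 s ⟨hs.1, by simpa using hs0⟩
    | succ k ih =>
      obtain ⟨C, hC, ih⟩ := ih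
      refine ⟨2 + 4 * L * C + C, by positivity, fun S a u hS ha huc hu0 h0 hu s hs hsk => ?_⟩
      have hold := ih S a u hS ha huc hu0 h0 hu
      have hCa : C * a ≤ (2 + 4 * L * C + C) * a := by
        have : 0 ≤ (2 + 4 * L * C) * a := by positivity
        nlinarith
      rcases le_or_gt s (k * η) with hsk' | hsk'
      · exact (hold s hs hsk').trans hCa
      set t₀ : ℝ := k * η with ht₀
      have ht₀0 : 0 ≤ t₀ := by positivity
      have ht₀S : t₀ ≤ S := hsk'.le.trans hs.2
      push_cast at hsk
      obtain ⟨p, hp, hpmax⟩ := (isCompact_Icc (a := t₀) (b := s)).exists_isMaxOn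
        ⟨s, hsk'.le, le_rfl⟩ (huc.mono (Icc_subset_Icc (by linarith) hs.2))
      have hps : p ≤ S := hp.2.trans hs.2
      have hp0 : 0 ≤ p := ht₀0.trans hp.1
      have hup : 0 ≤ u p := hu0 p ⟨by linarith, hps⟩
      have hint : ∀ c d, 0 ≤ c → c ≤ d → d ≤ S →
          IntervalIntegrable (fun r => l r * (u r + u (r - 1))) volume c d := by
        intro c d hc hcd hd
        refine (hli c d).mul_continuousOn ?_
        rw [uIcc_of_le hcd]
        refine (huc.mono (Icc_subset_Icc (by linarith) hd)).add
          (huc.comp (by fun_prop) fun r hr => ⟨by linarith [hr.1], by linarith [hr.2]⟩)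
      have h1 : ∫ r in 0..t₀, l r * (u r + u (r - 1)) ≤ L * (2 * (C * a)) := by
        calc ∫ r in 0..t₀, l r * (u r + u (r - 1)) ≤ ∫ r in 0..t₀, l r * (2 * (C * a)) := by
              refine intervalIntegral.integral_mono_on ht₀0 (hint _ _ le_rfl ht₀0 (by linarith))
                ((hli _ _).mul_const _) fun r hr => ?_
              have e1 := hold r ⟨by linarith [hr.1], by linarith [hr.2]⟩ hr.2
              have e2 := hold (r - 1) ⟨by linarith [hr.1], by linarith [hr.2]⟩ (by linarith [hr.2])
              exact mul_le_mul_of_nonneg_left (by linarith) (hl0 r)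
          _ = (∫ r in 0..t₀, l r) * (2 * (C * a)) := intervalIntegral.integral_mul_const _ _
          _ ≤ L * (2 * (C * a)) := by
              refine mul_le_mul_of_nonneg_right ?_ (by positivity)
              exact intervalIntegral.integral_mono_interval le_rfl ht₀0 (by linarith)
                (Eventually.of_forall hl0) (hli _ _)
      have h2 : ∫ r in t₀..p, l r * (u r + u (r - 1)) ≤ 1 / 2 * (u p + C * a) := by
        calc ∫ r in t₀..p, l r * (u r + u (r - 1)) ≤ ∫ r in t₀..p, l r * (u p + C * a) := by
              refine intervalIntegral.integral_mono_on hp.1 (hint _ _ ht₀0 hp.1 hps)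
                ((hli _ _).mul_const _) fun r hr => ?_
              have e1 : u r ≤ u p := hpmax ⟨hr.1, hr.2.trans hp.2⟩
              have e2 := hold (r - 1) ⟨by linarith [hr.1], by linarith [hr.2]⟩
                (by linarith [hr.2, hp.2, min_le_right δ 1])
              exact mul_le_mul_of_nonneg_left (by linarith) (hl0 r)
          _ = (∫ r in t₀..p, l r) * (u p + C * a) := intervalIntegral.integral_mul_const _ _
          _ ≤ 1 / 2 * (u p + C * a) := by
              refine mul_le_mul_of_nonneg_right ?_ (by positivity)
              exact hlδ t₀ p ht₀0 hp.1 (hps.trans hS) (by linarith [hp.2, min_le_left δ 1])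
      have h3 := hu p ⟨hp0, hps⟩
      rw [← intervalIntegral.integral_add_adjacent_intervals
        (hint 0 t₀ le_rfl ht₀0 (by linarith)) (hint t₀ p ht₀0 hp.1 hps)] at h3
      have h4 : u s ≤ u p := hpmax ⟨hsk'.le, le_rfl⟩
      nlinarith
  obtain ⟨k, hk⟩ := exists_nat_ge (T / η)
  obtain ⟨C, hC, h⟩ := key k
  refine ⟨C, hC, fun S a u hS ha huc hu0 h0 hu s hs => h S a u hS ha huc hu0 h0 hu s hs ?_⟩
  rw [div_le_iff₀ hη0] at hk
  linarith [hs.2]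

/-! ### Carathéodory solutions: uniqueness, concatenation -/

theorem norm_apply_le (φ : Hist N) (s : Icc (-1 : ℝ) 0) : ‖φ s‖ ≤ ‖φ‖ := φ.norm_coe_le_norm s

namespace IsSolutionOn

variable {f : LC N} {φ : Hist N} {T : ℝ} {x z : ℝ → V N}

theorem continuousOn_delay (h : IsSolutionOn f φ T x) :
    ContinuousOn (fun r => x (r - 1)) (Icc 0 T) :=
  h.1.comp (by fun_prop) fun r hr => ⟨by linarith [hr.1], by linarith [hr.2]⟩

theorem apply_of_mem (h : IsSolutionOn f φ T x) {s : ℝ} (hs : s ∈ Icc (-1 : ℝ) 0) :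
    x s = φ ⟨s, hs⟩ := h.2.1 ⟨s, hs⟩

theorem intervalIntegrable_comp (h : IsSolutionOn f φ T x) (g : LC N) {s t : ℝ} (hs : 0 ≤ s)
    (hst : s ≤ t) (ht : t ≤ T) :
    IntervalIntegrable (fun r => g r (x r) (x (r - 1))) volume s t :=
  g.intervalIntegrable hst (h.1.mono (Icc_subset_Icc (by linarith) ht))
    (h.continuousOn_delay.mono (Icc_subset_Icc hs ht))

theorem sub_eq (h : IsSolutionOn f φ T x) {s t : ℝ} (hs : 0 ≤ s) (hst : s ≤ t) (ht : t ≤ T) :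
    x t - x s = ∫ r in s..t, f r (x r) (x (r - 1)) := by
  rw [h.2.2 t ⟨hs.trans hst, ht⟩, h.2.2 s ⟨hs, hst.trans ht⟩,
    ← intervalIntegral.integral_interval_sub_left
      (h.intervalIntegrable_comp f le_rfl (hs.trans hst) ht)
      (h.intervalIntegrable_comp f le_rfl hs (hst.trans ht))]
  abel

theorem mono (h : IsSolutionOn f φ T x) {S : ℝ} (hS : S ≤ T) : IsSolutionOn f φ S x :=
  ⟨h.1.mono (Icc_subset_Icc le_rfl hS), h.2.1, fun t ht => h.2.2 t ⟨ht.1, ht.2.trans hS⟩⟩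

theorem congr (h : IsSolutionOn f φ T x) (hT : 0 ≤ T) (hxz : EqOn z x (Icc (-1) T)) :
    IsSolutionOn f φ T z := by
  refine ⟨h.1.congr hxz, fun s => ?_, fun t ht => ?_⟩
  · rw [hxz ⟨s.2.1, s.2.2.trans hT⟩, h.2.1]
  · rw [hxz ⟨by linarith [ht.1], ht.2⟩, h.2.2 t ht]
    congr 1
    refine intervalIntegral.integral_congr fun r hr => ?_
    rw [uIcc_of_le ht.1] at hr
    rw [hxz ⟨by linarith [hr.1], by linarith [hr.2, ht.2]⟩,
      hxz ⟨by linarith [hr.1], by linarith [hr.2, ht.2]⟩]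

theorem exists_norm_le (h : IsSolutionOn f φ T x) : ∃ R, 0 ≤ R ∧ ∀ s ∈ Icc (-1) T, ‖x s‖ ≤ R := by
  obtain ⟨R, hR⟩ := isCompact_Icc.exists_bound_of_continuousOn h.1
  exact ⟨max R 0, le_max_right _ _, fun s hs => (hR s hs).trans (le_max_left _ _)⟩

/-- Carathéodory solutions are unique. -/
theorem eqOn (hx : IsSolutionOn f φ T x) (hz : IsSolutionOn f φ T z) (hT : 0 ≤ T) :
    EqOn x z (Icc (-1) T) := by
  obtain ⟨Rx, hRx0, hRx⟩ := hx.exists_norm_le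
  obtain ⟨Rz, hRz0, hRz⟩ := hz.exists_norm_le
  obtain ⟨l, hl, hl0, hlip⟩ := f.exists_lipschitz (max Rx Rz)
  obtain ⟨C, hC, hG⟩ := exists_delay_gronwall hl hl0 hT
  have hcont : ContinuousOn (fun s => ‖x s - z s‖) (Icc (-1) T) := (hx.1.sub hz.1).norm
  intro s hs
  have := hG T 0 (fun s => ‖x s - z s‖) le_rfl le_rfl hcont (fun _ _ => norm_nonneg _)
    (fun s hs => by simp [hx.apply_of_mem hs, hz.apply_of_mem hs]) (fun s hs => ?_) s hs
  · rw [mul_zero] at this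
    exact sub_eq_zero.1 (norm_le_zero_iff.1 this)
  · rw [zero_add, hx.2.2 s hs, hz.2.2 s hs, add_sub_add_left_eq_sub,
      ← intervalIntegral.integral_sub (hx.intervalIntegrable_comp f le_rfl hs.1 hs.2)
        (hz.intervalIntegrable_comp f le_rfl hs.1 hs.2)]
    refine intervalIntegral.norm_integral_le_of_norm_le hs.1 ?_ ?_
    · filter_upwards [hlip] with r hr hrs
      have h1 : r ∈ Icc (-1) T := ⟨by linarith [hrs.1], hrs.2.trans hs.2⟩
      have h2 : r - 1 ∈ Icc (-1) T := ⟨by linarith [hrs.1], by linarith [hrs.2, hs.2]⟩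
      exact hr _ _ _ _ ((hRx _ h1).trans (le_max_left _ _)) ((hRx _ h2).trans (le_max_left _ _))
        ((hRz _ h1).trans (le_max_right _ _)) ((hRz _ h2).trans (le_max_right _ _))
    · refine (locallyIntegrable_intervalIntegrable hl _ _).mul_continuousOn ?_
      rw [uIcc_of_le hs.1]
      exact (hcont.mono (Icc_subset_Icc (by linarith) hs.2)).add (hcont.comp (by fun_prop)
        fun r hr => ⟨by linarith [hr.1], by linarith [hr.2, hs.2]⟩)

/-- The time translate of a solution solves the translated equation. -/
theorem shift {S t : ℝ} (hS : 0 ≤ S) (hx : IsSolutionOn f φ (S + t) x) {ψ : Hist N}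
    (hψ : ∀ s, ψ s = x (S + s)) : IsSolutionOn (translate S f) ψ t fun r => x (S + r) := by
  refine ⟨hx.1.comp (by fun_prop) fun r hr => ⟨by linarith [hr.1], by linarith [hr.2]⟩,
    fun s => (hψ s).symm, fun r hr => ?_⟩
  have h1 := hx.sub_eq hS (t := S + r) (by linarith [hr.1]) (by linarith [hr.2])
  have h2 := intervalIntegral.integral_comp_add_left (a := 0) (b := r)
    (fun r => f r (x r) (x (r - 1))) S
  rw [add_zero] at h2
  rw [hψ, add_zero, ← sub_eq_iff_eq_add', h1, ← h2]
  refine intervalIntegral.integral_congr fun q _ => ?_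
  simp only [translate, add_sub_assoc]

/-- Concatenation of solutions. -/
theorem glue {S t : ℝ} (hS : 0 ≤ S) (ht : 0 ≤ t) (hx : IsSolutionOn f φ S x) {ψ : Hist N}
    (hψ : ∀ s, ψ s = x (S + s)) (hz : IsSolutionOn (translate S f) ψ t z) :
    IsSolutionOn f φ (S + t) fun r => if r ≤ S then x r else z (r - S) := by
  set y : ℝ → V N := fun r => if r ≤ S then x r else z (r - S) with hy
  have hyx : EqOn y x (Iic S) := fun r hr => if_pos hr
  have hyz : ∀ r, S - 1 ≤ r → y r = z (r - S) := by
    intro r hr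
    rcases le_or_gt r S with h | h
    · rw [hyx h, hz.apply_of_mem (s := r - S) ⟨by linarith, by linarith⟩, hψ]
      simp
    · exact if_neg (not_le.2 h)
  have hc1 : ContinuousOn y (Icc (-1) S) := hx.1.congr fun r hr => hyx hr.2
  have hc2 : ContinuousOn y (Icc (S - 1) (S + t)) :=
    (hz.1.comp (f := fun r => r - S) (s := Icc (S - 1) (S + t)) (by fun_prop)
      fun r hr => ⟨by linarith [hr.1], by linarith [hr.2]⟩).congr fun r hr => hyz r hr.1
  have hcont : ContinuousOn y (Icc (-1) (S + t)) := by
    refine (hc1.union_of_isClosed (hc2.mono (Icc_subset_Icc (a₁ := S) (by linarith) le_rfl))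
      isClosed_Icc isClosed_Icc).mono fun r hr => ?_
    rcases le_or_gt r S with h | h
    · exact Or.inl ⟨hr.1, h⟩
    · exact Or.inr ⟨h.le, hr.2⟩
  have hdc : ContinuousOn (fun r => y (r - 1)) (Icc 0 (S + t)) :=
    hcont.comp (by fun_prop) fun r hr => ⟨by linarith [hr.1], by linarith [hr.2]⟩
  have hold : ∀ r ∈ Icc 0 S, y r = φ ⟨0, by norm_num⟩ + ∫ s in 0..r, f s (y s) (y (s - 1)) := by
    intro r hr
    rw [hyx hr.2, hx.2.2 r hr]
    congr 1
    refine intervalIntegral.integral_congr fun q hq => ?_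
    rw [uIcc_of_le hr.1] at hq
    rw [hyx (show q ≤ S from hq.2.trans hr.2), hyx (show q - 1 ≤ S by linarith [hq.2, hr.2])]
  refine ⟨hcont, fun s => ?_, fun r hr => ?_⟩
  · rw [hyx (show (s : ℝ) ≤ S from s.2.2.trans hS), hx.2.1]
  · rcases le_or_gt r S with h | h
    · exact hold r ⟨hr.1, h⟩
    · have hint : ∀ c d, 0 ≤ c → c ≤ d → d ≤ S + t →
          IntervalIntegrable (fun q => f q (y q) (y (q - 1))) volume c d := fun c d hc hcd hd =>
        f.intervalIntegrable hcd (hcont.mono (Icc_subset_Icc (by linarith) hd))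
          (hdc.mono (Icc_subset_Icc hc hd))
      rw [← intervalIntegral.integral_add_adjacent_intervals (hint 0 S le_rfl hS (by linarith))
        (hint S r hS h.le hr.2), ← add_assoc, ← hold S ⟨hS, le_rfl⟩, hyz r (by linarith),
        hz.2.2 (r - S) ⟨by linarith, by linarith [hr.2]⟩, hψ, add_zero, hyx (mem_Iic.2 le_rfl)]
      congr 1
      have := intervalIntegral.integral_comp_add_left (a := 0) (b := r - S)
        (fun q => f q (y q) (y (q - 1))) S
      rw [add_zero, add_sub_cancel] at this
      rw [← this]
      refine intervalIntegral.integral_congr fun q hq => ?_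
      rw [uIcc_of_le (by linarith)] at hq
      simp only [translate]
      rw [hyz (S + q) (by linarith [hq.1]), hyz (S + q - 1) (by linarith [hq.1])]
      congr 2 <;> ring

end IsSolutionOn

/-! ### Local existence -/

theorem continuous_comp_projIcc_sub_one (φ : Hist N) :
    Continuous fun r : ℝ => φ (projIcc (-1) 0 (by norm_num) (r - 1)) := by
  fun_prop

/-- Local existence by the contraction principle, on an interval `[0, δ]`, `δ ≤ 1`, whose length
is determined by an `m`-bound and an `l`-bound only. -/
theorem exists_isSolutionOn_of_bounds (f : LC N) (φ : Hist N) {R δ : ℝ} {m l : ℝ → ℝ}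
    (hδ0 : 0 ≤ δ) (hδ1 : δ ≤ 1) (hφ : ∀ s, ‖φ s‖ ≤ R)
    (hm : LocallyIntegrable m volume) (hl : LocallyIntegrable l volume) (hl0 : ∀ t, 0 ≤ l t)
    (hmb : ∀ᵐ t : ℝ, ∀ a b : V N, ‖a‖ ≤ R + 1 → ‖b‖ ≤ R + 1 → ‖f t a b‖ ≤ m t)
    (hlb : ∀ᵐ t : ℝ, ∀ a b a' b' : V N, ‖a‖ ≤ R + 1 → ‖b‖ ≤ R + 1 → ‖a'‖ ≤ R + 1 → ‖b'‖ ≤ R + 1 →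
      ‖f t a b - f t a' b'‖ ≤ l t * (‖a - a'‖ + ‖b - b'‖))
    (hm1 : ∀ t ∈ Icc 0 δ, ∫ r in 0..t, m r ≤ 1) (hl1 : ∀ t ∈ Icc 0 δ, ∫ r in 0..t, l r ≤ 1 / 2) :
    ∃ x, IsSolutionOn f φ δ x := by
  set p0 : V N := φ ⟨0, by norm_num⟩ with hp0
  have hR0 : 0 ≤ R := (norm_nonneg _).trans (hφ ⟨0, by norm_num⟩)
  set y : ℝ → V N := fun r => φ (projIcc (-1) 0 (by norm_num) (r - 1)) with hy
  have hyc : Continuous y := continuous_comp_projIcc_sub_one φ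
  have hyR : ∀ r, ‖y r‖ ≤ R + 1 := fun r => (hφ _).trans (by linarith)
  let X : Type := {z : C(Icc 0 δ, V N) // ∀ t, ‖z t‖ ≤ R + 1}
  have hclosed : IsClosed {z : C(Icc 0 δ, V N) | ∀ t, ‖z t‖ ≤ R + 1} := by
    simp only [Set.ofPred_forall]
    exact isClosed_iInter fun t => isClosed_le (by fun_prop) continuous_const
  have : CompleteSpace X := hclosed.completeSpace_coe
  let e : X → ℝ → V N := fun z r => z.1 (projIcc 0 δ hδ0 r)
  have hec : ∀ z, Continuous (e z) := fun z => z.1.continuous.comp continuous_projIcc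
  have heR : ∀ z r, ‖e z r‖ ≤ R + 1 := fun z r => z.2 _
  have hint : ∀ z c d, IntervalIntegrable (fun r => f r (e z r) (y r)) volume c d := by
    intro z c d
    rcases le_total c d with h | h
    · exact f.intervalIntegrable h (hec z).continuousOn hyc.continuousOn
    · exact (f.intervalIntegrable h (hec z).continuousOn hyc.continuousOn).symm
  let F : X → ℝ → V N := fun z t => p0 + ∫ r in 0..t, f r (e z r) (y r)
  have hFc : ∀ z, Continuous (F z) := fun z =>
    continuous_const.add (intervalIntegral.continuous_primitive (hint z) 0)
  have hFR : ∀ z, ∀ t ∈ Icc 0 δ, ‖F z t‖ ≤ R + 1 := by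
    intro z t ht
    refine (norm_add_le _ _).trans (add_le_add (hφ _) (le_trans ?_ (hm1 t ht)))
    refine intervalIntegral.norm_integral_le_of_norm_le ht.1 ?_
      (locallyIntegrable_intervalIntegrable hm _ _)
    filter_upwards [hmb] with r hr _
    exact hr _ _ (heR z r) (hyR r)
  let Ψ : X → X := fun z => ⟨⟨fun t => F z t, (hFc z).comp continuous_subtype_val⟩,
    fun t => hFR z t t.2⟩
  have hΨ : ContractingWith (1 / 2) Ψ := by
    refine ⟨by rw [← NNReal.coe_lt_coe]; norm_num, LipschitzWith.of_dist_le_mul fun z z' => ?_⟩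
    change dist (Ψ z).1 (Ψ z').1 ≤ _ * dist z.1 z'.1
    rw [ContinuousMap.dist_le (by positivity)]
    intro t
    change dist (F z t) (F z' t) ≤ _
    rw [dist_eq_norm, add_sub_add_left_eq_sub,
      ← intervalIntegral.integral_sub (hint _ _ _) (hint _ _ _)]
    calc ‖∫ r in 0..(t : ℝ), (f r (e z r) (y r) - f r (e z' r) (y r))‖
        ≤ ∫ r in 0..(t : ℝ), l r * dist z.1 z'.1 := by
          refine intervalIntegral.norm_integral_le_of_norm_le t.2.1 ?_
            ((locallyIntegrable_intervalIntegrable hl _ _).mul_const _)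
          filter_upwards [hlb] with r hr _
          refine (hr _ _ _ _ (heR z r) (hyR r) (heR z' r) (hyR r)).trans ?_
          refine mul_le_mul_of_nonneg_left ?_ (hl0 r)
          rw [sub_self, norm_zero, add_zero, ← dist_eq_norm]
          exact ContinuousMap.dist_apply_le_dist _
      _ = (∫ r in 0..(t : ℝ), l r) * dist z.1 z'.1 := intervalIntegral.integral_mul_const _ _
      _ ≤ ((1 / 2 : NNReal) : ℝ) * dist z.1 z'.1 := by
          refine mul_le_mul_of_nonneg_right ((hl1 t t.2).trans ?_) dist_nonneg
          norm_num
  have : Nonempty X := ⟨⟨0, fun t => by simp; linarith⟩⟩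
  set z : X := hΨ.fixedPoint with hz
  have hfix : ∀ t ∈ Icc 0 δ, e z t = F z t := by
    intro t ht
    have h1 : Ψ z = z := hΨ.fixedPoint_isFixedPt
    have h2 : e z t = z.1 ⟨t, ht⟩ := by simp only [e, projIcc_of_mem hδ0 ht]
    have h3 : (Ψ z).1 ⟨t, ht⟩ = F z t := rfl
    rw [h2, ← h3, h1]
  set x : ℝ → V N := fun r => if r ≤ 0 then φ (projIcc (-1) 0 (by norm_num) r) else e z r with hx
  have hx0 : ∀ s (hs : s ∈ Icc (-1 : ℝ) 0), x s = φ ⟨s, hs⟩ := by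
    intro s hs
    simp only [hx, if_pos hs.2, projIcc_of_mem _ hs]
  have hxe : ∀ r, 0 ≤ r → r ≤ δ → x r = e z r := by
    intro r hr hrδ
    rcases hr.eq_or_lt with h | h
    · rw [← h, hx0 0 (by norm_num), hfix 0 ⟨le_rfl, hδ0⟩]
      simp [F, hp0]
    · exact if_neg (not_le.2 h)
  refine ⟨x, Continuous.continuousOn ?_, fun s => hx0 s s.2, fun t ht => ?_⟩
  · refine Continuous.if_le (by fun_prop) (hec z) continuous_id continuous_const fun r hr => ?_
    subst hr
    have h1 := hxe 0 le_rfl hδ0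
    simpa only [hx, le_refl, if_true] using h1
  · rw [hxe t ht.1 ht.2, hfix t ht]
    refine congrArg (p0 + ·) (intervalIntegral.integral_congr fun r hr => ?_)
    rw [uIcc_of_le ht.1] at hr
    simp only [y]
    rw [hxe r hr.1 (hr.2.trans ht.2), hx0 (r - 1) ⟨by linarith [hr.1], by linarith [hr.2, ht.2]⟩,
      projIcc_of_mem _ ⟨by linarith [hr.1], by linarith [hr.2, ht.2]⟩]

/-- The segment `s ↦ x(S + s)` of a solution as an element of the phase space. -/
def IsSolutionOn.history {f : LC N} {φ : Hist N} {S : ℝ} {x : ℝ → V N} (h : IsSolutionOn f φ S x)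
    (hS : 0 ≤ S) : Hist N :=
  ⟨fun s => x (S + s), h.1.comp_continuous (by fun_prop)
    fun s => ⟨by linarith [s.2.1], by linarith [s.2.2]⟩⟩

/-- A solution with values in a ball of radius `R` can be continued by a step that depends only on
the equation, on `R`, and on an upper bound `T` for the time. -/
theorem exists_uniform_continuation (f : LC N) (R T : ℝ) : ∃ δ > (0 : ℝ), ∀ (φ : Hist N) (S : ℝ)
    (x : ℝ → V N), 0 ≤ S → S ≤ T → IsSolutionOn f φ S x → (∀ s ∈ Icc (-1) S, ‖x s‖ ≤ R) →
      ∃ z, IsSolutionOn f φ (S + δ) z := by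
  obtain ⟨m, hm, -, hmb⟩ := f.exists_mbound (R + 1)
  obtain ⟨l, hl, hl0, hlb⟩ := f.exists_lipschitz (R + 1)
  obtain ⟨δ₁, hδ₁, h₁⟩ := exists_integral_le_of_locallyIntegrable hm 0 (T + 1) one_pos
  obtain ⟨δ₂, hδ₂, h₂⟩ := exists_integral_le_of_locallyIntegrable hl 0 (T + 1)
    (ε := 1 / 2) (by norm_num)
  set δ := min (min δ₁ δ₂) 1 with hδ
  have hδ0 : 0 < δ := by positivity
  have hδ1 : δ ≤ 1 := min_le_right _ _
  have hδδ₁ : δ ≤ δ₁ := (min_le_left _ _).trans (min_le_left _ _)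
  have hδδ₂ : δ ≤ δ₂ := (min_le_left _ _).trans (min_le_right _ _)
  refine ⟨δ, hδ0, fun φ S x hS hST hx hxR => ?_⟩
  have hshift : ∀ (h : ℝ → ℝ) (t : ℝ), ∫ r in 0..t, h (S + r) = ∫ r in S..(S + t), h r := by
    intro h t
    rw [intervalIntegral.integral_comp_add_left (fun r => h r) S, add_zero]
  obtain ⟨z, hz⟩ := exists_isSolutionOn_of_bounds (translate S f) (hx.history hS) (R := R)
    (m := fun r => m (S + r)) (l := fun r => l (S + r)) hδ0.le hδ1
    (fun s => hxR _ ⟨by linarith [s.2.1], by linarith [s.2.2]⟩)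
    (locallyIntegrable_translate hm S) (locallyIntegrable_translate hl S) (fun t => hl0 _)
    (ae_translate hmb S) (ae_translate hlb S)
    (fun t ht => by
      rw [hshift]
      exact h₁ _ _ hS (by linarith [ht.1]) (by linarith [ht.2]) (by linarith [ht.2]))
    (fun t ht => by
      rw [hshift]
      exact h₂ _ _ hS (by linarith [ht.1]) (by linarith [ht.2]) (by linarith [ht.2]))
  exact ⟨_, hx.glue hS hδ0.le (fun s => rfl) hz⟩

/-! ### The maximal solution -/

theorem isSolutionOn_zero (f : LC N) (φ : Hist N) :
    IsSolutionOn f φ 0 fun r => φ (projIcc (-1) 0 (by norm_num) r) := by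
  refine ⟨Continuous.continuousOn (by fun_prop), fun s => ?_, fun t ht => ?_⟩
  · simp only [projIcc_val]
  · obtain rfl : t = 0 := le_antisymm ht.2 ht.1
    simp only [intervalIntegral.integral_same, add_zero]
    rw [projIcc_of_mem _ ⟨by norm_num, le_rfl⟩]

/-- `sol` chooses a solution for each time separately; by uniqueness it agrees with any solution. -/
theorem IsSolutionOn.sol_eqOn {f : LC N} {φ : Hist N} {T : ℝ} {x : ℝ → V N}
    (hx : IsSolutionOn f φ T x) (hT : 0 ≤ T) : EqOn (sol f φ) x (Icc (-1) T) := by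
  intro t ht
  have h : ExistsUpTo f φ t := ⟨x, T, hT, ht.2, hx⟩
  rw [sol, dif_pos h]
  obtain ⟨S, hS, htS, hsol⟩ := h.choose_spec
  rcases le_total S T with h' | h'
  · exact hsol.eqOn (hx.mono h') hS ⟨ht.1, htS⟩
  · exact (hsol.mono h').eqOn hx hT ht

theorem IsSolutionOn.isSolutionOn_sol {f : LC N} {φ : Hist N} {T : ℝ} {x : ℝ → V N}
    (hx : IsSolutionOn f φ T x) (hT : 0 ≤ T) : IsSolutionOn f φ T (sol f φ) :=
  hx.congr hT (hx.sol_eqOn hT)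

theorem mem_maxInterval_iff {f : LC N} {φ : Hist N} {T : ℝ} (hT : 0 ≤ T) :
    T ∈ maxInterval f φ ↔ IsSolutionOn f φ T (sol f φ) := by
  refine ⟨fun ⟨_, x, S, hS, hTS, hx⟩ => (hx.isSolutionOn_sol hS).mono hTS, fun h =>
    ⟨by linarith, _, T, hT, le_rfl, h⟩⟩

theorem mem_maxInterval_of_le {f : LC N} {φ : Hist N} {T t : ℝ} (hT : T ∈ maxInterval f φ)
    (ht1 : -1 ≤ t) (ht : t ≤ T) : t ∈ maxInterval f φ := by
  obtain ⟨_, x, S, hS, hTS, hx⟩ := hT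
  exact ⟨ht1, x, S, hS, ht.trans hTS, hx⟩

theorem zero_mem_maxInterval (f : LC N) (φ : Hist N) : (0 : ℝ) ∈ maxInterval f φ :=
  ⟨by norm_num, _, 0, le_rfl, le_rfl, isSolutionOn_zero f φ⟩

theorem sol_of_mem_Icc (f : LC N) (φ : Hist N) {s : ℝ} (hs : s ∈ Icc (-1 : ℝ) 0) :
    sol f φ s = φ ⟨s, hs⟩ := by
  rw [(isSolutionOn_zero f φ).sol_eqOn le_rfl hs]
  simp only [projIcc_of_mem _ hs]

/-- The maximal interval of existence is open to the right. -/
theorem exists_add_mem_maxInterval {f : LC N} {φ : Hist N} {T : ℝ} (hT : 0 ≤ T)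
    (h : T ∈ maxInterval f φ) : ∃ δ > 0, T + δ ∈ maxInterval f φ := by
  rw [mem_maxInterval_iff hT] at h
  obtain ⟨R, -, hR⟩ := h.exists_norm_le
  obtain ⟨δ, hδ, H⟩ := exists_uniform_continuation f R T
  obtain ⟨z, hz⟩ := H φ T _ hT le_rfl h hR
  exact ⟨δ, hδ, by linarith, z, T + δ, by linarith, le_rfl, hz⟩

/-- A maximal solution that does not exist up to time `T` is unbounded before `T`. -/
theorem exists_lt_norm_sol {f : LC N} {φ : Hist N} {T : ℝ} (h : T ∉ maxInterval f φ)
    (hT : 0 ≤ T) (R : ℝ) : ∃ t, 0 ≤ t ∧ t < T ∧ t ∈ maxInterval f φ ∧ R < ‖sol f φ t‖ := by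
  by_contra! hc
  obtain ⟨δ, hδ, H⟩ := exists_uniform_continuation f (max R ‖φ‖) T
  have hlt : ∀ t, t ∈ maxInterval f φ → t < T := fun t ht => by
    by_contra! hTt
    exact h (mem_maxInterval_of_le ht (by linarith) hTt)
  have key : ∀ k : ℕ, (k : ℝ) * δ ∈ maxInterval f φ := by
    intro k
    induction k with
    | zero => simpa using zero_mem_maxInterval f φ
    | succ k ih =>
      have hk0 : 0 ≤ (k : ℝ) * δ := by positivity
      obtain ⟨z, hz⟩ := H φ _ _ hk0 (hlt _ ih).le ((mem_maxInterval_iff hk0).1 ih) fun s hs => by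
        rcases le_total s 0 with hs0 | hs0
        · rw [sol_of_mem_Icc f φ ⟨hs.1, hs0⟩]
          exact (norm_apply_le φ _).trans (le_max_right _ _)
        · have hs' := mem_maxInterval_of_le ih hs.1 hs.2
          exact (hc s hs0 (hlt s hs') hs').trans (le_max_left _ _)
      push_cast
      rw [add_one_mul]
      exact ⟨by linarith, z, _, by linarith, le_rfl, hz⟩
  obtain ⟨k, hk⟩ := exists_nat_ge (T / δ)
  rw [div_le_iff₀ hδ] at hk
  exact absurd (hlt _ (key k)) (not_lt.2 hk)

theorem segment_apply {f : LC N} {φ : Hist N} {t : ℝ} (ht : 0 ≤ t) (h : t ∈ maxInterval f φ)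
    (s : Icc (-1 : ℝ) 0) : segment f φ t s = sol f φ (t + s) := by
  have hc : Continuous fun s : Icc (-1 : ℝ) 0 => sol f φ (t + s) :=
    (((mem_maxInterval_iff ht).1 h).history ht).continuous
  rw [segment, dif_pos hc]
  rfl

/-- The cocycle property of the maximal solutions. -/
theorem add_mem_maxInterval_iff {f : LC N} {φ : Hist N} {s t : ℝ} (hs : 0 ≤ s) (ht : 0 ≤ t)
    (h : s ∈ maxInterval f φ) :
    s + t ∈ maxInterval f φ ↔ t ∈ maxInterval (translate s f) (segment f φ s) := by
  rw [mem_maxInterval_iff (add_nonneg hs ht), mem_maxInterval_iff ht]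
  constructor
  · intro h'
    exact (h'.shift hs fun r => segment_apply hs h r).isSolutionOn_sol ht
  · intro h'
    exact (((mem_maxInterval_iff hs).1 h).glue hs ht (fun r => segment_apply hs h r)
      h').isSolutionOn_sol (add_nonneg hs ht)

theorem segment_add {f : LC N} {φ : Hist N} {s t : ℝ} (hs : 0 ≤ s) (ht : 0 ≤ t)
    (h : s + t ∈ maxInterval f φ) :
    segment f φ (s + t) = segment (translate s f) (segment f φ s) t := by
  have hs' := mem_maxInterval_of_le h (by linarith) (le_add_of_nonneg_right ht)
  have ht' := (add_mem_maxInterval_iff hs ht hs').1 h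
  ext1 r
  rw [segment_apply (add_nonneg hs ht) h, segment_apply ht ht',
    (((mem_maxInterval_iff (add_nonneg hs ht)).1 h).shift hs
      fun r => segment_apply hs hs' r).sol_eqOn ht ⟨by linarith [r.2.1], by linarith [r.2.2]⟩,
    add_assoc]

theorem segment_zero (f : LC N) (φ : Hist N) : segment f φ 0 = φ := by
  ext1 r
  rw [segment_apply le_rfl (zero_mem_maxInterval f φ), zero_add, sol_of_mem_Icc f φ r.2]

/-! ### The topologies generated by the seminorms -/

/-- The distance of `g` and `f` in the weak seminorm with index `i`. -/
def weakDist (Θ : Moduli) (D : Set (V N)) (i : Idx D) (g f : LC N) : ℝ≥0∞ :=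
  weakSeminorm Θ D i fun t x y => g t x y - f t x y

/-- The distance of `g` and `f` in the strong seminorm with index `i`. -/
def strongDist (Θ : Moduli) (D : Set (V N)) (i : Idx D) (g f : LC N) : ℝ≥0∞ :=
  strongSeminorm Θ D i fun t x y => g t x y - f t x y

theorem weakDist_self (Θ : Moduli) (D : Set (V N)) (i : Idx D) (f : LC N) :
    weakDist Θ D i f f = 0 := by
  simp [weakDist, weakSeminorm]

theorem strongDist_self (Θ : Moduli) (D : Set (V N)) (i : Idx D) (f : LC N) :
    strongDist Θ D i f f = 0 := by
  simp [strongDist, strongSeminorm]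

theorem weakDist_comm (Θ : Moduli) (D : Set (V N)) (i : Idx D) (f g : LC N) :
    weakDist Θ D i f g = weakDist Θ D i g f := by
  unfold weakDist weakSeminorm
  refine iSup_congr fun x => iSup_congr fun _ => ?_
  rw [← enorm_neg, ← integral_neg]
  simp only [neg_sub]

theorem strongDist_comm (Θ : Moduli) (D : Set (V N)) (i : Idx D) (f g : LC N) :
    strongDist Θ D i f g = strongDist Θ D i g f := by
  unfold strongDist strongSeminorm
  refine iSup_congr fun x => iSup_congr fun _ => lintegral_congr fun t => ?_
  rw [← enorm_neg, neg_sub]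

theorem weakDist_triangle (Θ : Moduli) (D : Set (V N)) (i : Idx D) (f g h : LC N) :
    weakDist Θ D i f h ≤ weakDist Θ D i f g + weakDist Θ D i g h := by
  refine iSup₂_le fun x hx => ?_
  have hi : ∀ k : LC N, IntegrableOn (fun t => k t (x t) i.2.1) (Icc (i.1.1.1 : ℝ) i.1.1.2) :=
    fun k => k.integrableOn hx.1 continuousOn_const
  have h1 : ∫ t in Icc (i.1.1.1 : ℝ) i.1.1.2, (f t (x t) i.2.1 - h t (x t) i.2.1) =
      (∫ t in Icc (i.1.1.1 : ℝ) i.1.1.2, (f t (x t) i.2.1 - g t (x t) i.2.1)) +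
        ∫ t in Icc (i.1.1.1 : ℝ) i.1.1.2, (g t (x t) i.2.1 - h t (x t) i.2.1) := by
    refine Eq.trans ?_ (integral_add ((hi f).sub (hi g)) ((hi g).sub (hi h)))
    simp
  rw [h1]
  refine (enorm_add_le _ _).trans (add_le_add ?_ ?_)
  · exact le_iSup₂ (f := fun (x : ℝ → V N) (_ : x ∈ KSet N Θ i.1.1.1 i.1.1.2 i.2.2) =>
      ‖∫ t in Icc (i.1.1.1 : ℝ) i.1.1.2, (f t (x t) i.2.1 - g t (x t) i.2.1)‖ₑ) x hx
  · exact le_iSup₂ (f := fun (x : ℝ → V N) (_ : x ∈ KSet N Θ i.1.1.1 i.1.1.2 i.2.2) =>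
      ‖∫ t in Icc (i.1.1.1 : ℝ) i.1.1.2, (g t (x t) i.2.1 - h t (x t) i.2.1)‖ₑ) x hx

theorem strongDist_triangle (Θ : Moduli) (D : Set (V N)) (i : Idx D) (f g h : LC N) :
    strongDist Θ D i f h ≤ strongDist Θ D i f g + strongDist Θ D i g h := by
  refine iSup₂_le fun x hx => ?_
  have hi : ∀ k : LC N, IntegrableOn (fun t => k t (x t) i.2.1) (Icc (i.1.1.1 : ℝ) i.1.1.2) :=
    fun k => k.integrableOn hx.1 continuousOn_const
  calc ∫⁻ t in Icc (i.1.1.1 : ℝ) i.1.1.2, ‖f t (x t) i.2.1 - h t (x t) i.2.1‖ₑ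
      ≤ ∫⁻ t in Icc (i.1.1.1 : ℝ) i.1.1.2, (‖f t (x t) i.2.1 - g t (x t) i.2.1‖ₑ +
          ‖g t (x t) i.2.1 - h t (x t) i.2.1‖ₑ) := lintegral_mono fun t => by
        refine le_trans (le_of_eq ?_) (enorm_add_le _ _)
        congr 1
        abel
    _ = (∫⁻ t in Icc (i.1.1.1 : ℝ) i.1.1.2, ‖f t (x t) i.2.1 - g t (x t) i.2.1‖ₑ) +
          ∫⁻ t in Icc (i.1.1.1 : ℝ) i.1.1.2, ‖g t (x t) i.2.1 - h t (x t) i.2.1‖ₑ :=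
        lintegral_add_left' ((hi f).sub (hi g)).aestronglyMeasurable.enorm _
    _ ≤ _ := add_le_add
        (le_iSup₂ (f := fun (x : ℝ → V N) (_ : x ∈ KSet N Θ i.1.1.1 i.1.1.2 i.2.2) =>
          ∫⁻ t in Icc (i.1.1.1 : ℝ) i.1.1.2, ‖f t (x t) i.2.1 - g t (x t) i.2.1‖ₑ) x hx)
        (le_iSup₂ (f := fun (x : ℝ → V N) (_ : x ∈ KSet N Θ i.1.1.1 i.1.1.2 i.2.2) =>
          ∫⁻ t in Icc (i.1.1.1 : ℝ) i.1.1.2, ‖g t (x t) i.2.1 - h t (x t) i.2.1‖ₑ) x hx)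

theorem weakDist_le_strongDist (Θ : Moduli) (D : Set (V N)) (i : Idx D) (g f : LC N) :
    weakDist Θ D i g f ≤ strongDist Θ D i g f :=
  iSup₂_mono fun _ _ => enorm_integral_le_lintegral_enorm _

/-- In the topology generated by the distances to all points, convergence to `f` follows from the
convergence to `0` of the distances to `f` alone. The distances may be infinite. -/
theorem tendsto_nhds_of_dist {ι α : Type} {d : ι → LC N → LC N → ℝ≥0∞}
    (hcomm : ∀ i f g, d i f g = d i g f) (htri : ∀ i f g h, d i f h ≤ d i f g + d i g h)
    {l : Filter α} {F : α → LC N} {f : LC N} (h : ∀ i, Tendsto (fun a => d i (F a) f) l (𝓝 0)) :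
    Tendsto F l (@nhds _ (⨅ (i : ι) (f : LC N), TopologicalSpace.induced
      (fun g : LC N => d i g f) inferInstance) f) := by
  simp only [nhds_iInf, nhds_induced, tendsto_iInf, tendsto_comap_iff]
  intro i k
  have h1 : Tendsto (fun a => d i f k - d i (F a) f) l (𝓝 (d i f k - 0)) :=
    ENNReal.Tendsto.sub tendsto_const_nhds (h i) (Or.inr ENNReal.zero_ne_top)
  have h2 : Tendsto (fun a => d i (F a) f + d i f k) l (𝓝 (0 + d i f k)) :=
    (h i).add tendsto_const_nhds
  rw [tsub_zero] at h1
  rw [zero_add] at h2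
  refine tendsto_of_tendsto_of_tendsto_of_le_of_le h1 h2 (fun a => ?_) (fun a => htri _ _ _ _)
  rw [tsub_le_iff_left, hcomm i (F a) f]
  exact htri _ _ _ _

theorem eventually_dist_lt {ι : Type} {d : ι → LC N → LC N → ℝ≥0∞}
    (hself : ∀ i f, d i f f = 0) (i : ι) (f : LC N) {ε : ℝ≥0∞} (hε : 0 < ε) :
    ∀ᶠ g in @nhds _ (⨅ (i : ι) (f : LC N), TopologicalSpace.induced
      (fun g : LC N => d i g f) inferInstance) f, d i g f < ε := by
  simp only [nhds_iInf, nhds_induced]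
  refine Filter.Eventually.filter_mono (iInf₂_le i f) ?_
  rw [eventually_comap]
  rw [hself]
  filter_upwards [gt_mem_nhds hε] with b hb g hg
  rwa [hg]

theorem eventually_weakDist_lt (Θ : Moduli) (D : Set (V N)) (i : Idx D) (f : LC N) {ε : ℝ≥0∞}
    (hε : 0 < ε) : ∀ᶠ g in @nhds _ (sigmaTop Θ D) f, weakDist Θ D i g f < ε :=
  eventually_dist_lt (d := weakDist Θ D) (weakDist_self Θ D) i f hε

theorem eventually_strongDist_lt (Θ : Moduli) (D : Set (V N)) (i : Idx D) (f : LC N) {ε : ℝ≥0∞}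
    (hε : 0 < ε) : ∀ᶠ g in @nhds _ (strongTop Θ D) f, strongDist Θ D i g f < ε :=
  eventually_dist_lt (d := strongDist Θ D) (strongDist_self Θ D) i f hε

theorem tendsto_sigmaTop {α : Type} {Θ : Moduli} {D : Set (V N)} {l : Filter α} {F : α → LC N}
    {f : LC N} (h : ∀ i, Tendsto (fun a => weakDist Θ D i (F a) f) l (𝓝 0)) :
    Tendsto F l (@nhds _ (sigmaTop Θ D) f) :=
  tendsto_nhds_of_dist (d := weakDist Θ D) (weakDist_comm Θ D) (weakDist_triangle Θ D) h

theorem nhds_strongTop_le (Θ : Moduli) (D : Set (V N)) (f : LC N) :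
    @nhds _ (strongTop Θ D) f ≤ @nhds _ (sigmaTop Θ D) f := by
  refine tendsto_id'.1 (tendsto_sigmaTop fun i => ?_)
  rw [ENNReal.tendsto_nhds_zero]
  intro ε hε
  filter_upwards [eventually_strongDist_lt Θ D i f hε] with g hg
  exact (weakDist_le_strongDist Θ D i g f).trans hg.le

theorem norm_integral_sub_le_of_weakDist_lt {Θ : Moduli} {D : Set (V N)} {i : Idx D} {g f : LC N}
    {x : ℝ → V N} {δ : ℝ} (hδ : 0 ≤ δ) (h : weakDist Θ D i g f < ENNReal.ofReal δ)
    (hx : x ∈ KSet N Θ i.1.1.1 i.1.1.2 i.2.2) :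
    ‖∫ t in (i.1.1.1 : ℝ)..i.1.1.2, (g t (x t) i.2.1 - f t (x t) i.2.1)‖ ≤ δ := by
  have h1 : ‖∫ t in Icc (i.1.1.1 : ℝ) i.1.1.2, (g t (x t) i.2.1 - f t (x t) i.2.1)‖ₑ ≤
      ENNReal.ofReal δ := (le_iSup₂ (f := fun (x : ℝ → V N)
        (_ : x ∈ KSet N Θ i.1.1.1 i.1.1.2 i.2.2) =>
      ‖∫ t in Icc (i.1.1.1 : ℝ) i.1.1.2, (g t (x t) i.2.1 - f t (x t) i.2.1)‖ₑ) x hx).trans h.le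
  rw [intervalIntegral.integral_of_le (by exact_mod_cast i.1.2.le), ← integral_Icc_eq_integral_Ioc]
  rwa [← ofReal_norm, ENNReal.ofReal_le_ofReal_iff hδ] at h1

/-! ### Uniform estimates for solutions of the equations in `E` -/

theorem mem_ball2 {a b : V N} {R : ℝ} {j : ℕ} (ha : ‖a‖ ≤ R) (hb : ‖b‖ ≤ R) (hj : 2 * R ≤ j) :
    (a, b) ∈ ball2 N j := by
  change ‖a‖ ^ 2 + ‖b‖ ^ 2 ≤ (j : ℝ) ^ 2
  nlinarith [norm_nonneg a, norm_nonneg b]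

theorem enorm_le_optMBound (g : LC N) (t : ℝ) {a b : V N} {j : ℕ} (h : (a, b) ∈ ball2 N j) :
    ‖g t a b‖ₑ ≤ optMBound g j t :=
  le_iSup₂_of_le (a, b) h le_rfl

theorem lintegral_optMBound_le_mBoundModuli {E : Set (LC N)} {g : LC N} (hg : g ∈ E) {q₁ q₂ : ℚ}
    (j : ℕ) {t : ℝ} (ht : t ∈ Icc (q₁ : ℝ) q₂) (s : ℝ) :
    ∫⁻ u in Icc t (t + s), optMBound g j u ≤ mBoundModuli E q₁ q₂ j s :=
  le_iSup₂_of_le t ht (le_iSup₂_of_le g hg le_rfl)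

/-- The integrals of the elements of a family with `L¹_loc`-equicontinuous `m`-bounds along bounded
curves are uniformly small over short intervals. -/
theorem HasL1LocEquicontinuousMBounds.exists_norm_integral_le {E : Set (LC N)}
    (hE : HasL1LocEquicontinuousMBounds E) (R T : ℝ) {ε : ℝ} (hε : 0 < ε) :
    ∃ δ > (0 : ℝ), ∀ g ∈ E, ∀ (z w : ℝ → V N) (s t : ℝ), -T ≤ s → s ≤ t → t ≤ T → t - s < δ →
      (∀ r ∈ Icc s t, ‖z r‖ ≤ R) → (∀ r ∈ Icc s t, ‖w r‖ ≤ R) →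
        ‖∫ r in s..t, g r (z r) (w r)‖ ≤ ε := by
  obtain ⟨j, hj⟩ := exists_nat_ge (2 * R)
  obtain ⟨S, hS, hSm, hSe⟩ := hE j
  obtain ⟨δ, hδ, h⟩ := hSe (max T 1) (by positivity) ε hε
  refine ⟨δ, hδ, fun g hg z w s t hs hst ht hd hz hw => ?_⟩
  obtain ⟨m, hmS, hm, hmb⟩ := hS g hg
  refine le_trans ?_ (h s t (by linarith [le_max_left T 1]) hst (ht.trans (le_max_left _ _))
    hd m hmS).le
  refine intervalIntegral.norm_integral_le_of_norm_le hst ?_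
    (locallyIntegrable_intervalIntegrable hm _ _)
  filter_upwards [hmb] with r hr hrs
  have h1 := hz r ⟨hrs.1.le, hrs.2⟩
  have h2 := hw r ⟨hrs.1.le, hrs.2⟩
  exact hr (z r, w r) (mem_ball2 h1 h2 hj)

/-- A single function is a family to which the uniform estimates apply; this includes limits that do
not belong to `E`. -/
theorem hasL1LocEquicontinuousMBounds_singleton (f : LC N) :
    HasL1LocEquicontinuousMBounds {f} := by
  intro j
  obtain ⟨m, hm, hm0, hb⟩ := f.exists_mbound j
  refine ⟨{m}, fun g hg => ⟨m, rfl, hm, ?_⟩, fun k hk => ?_, fun r _ ε hε => ?_⟩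
  · rw [mem_singleton_iff.1 hg]
    filter_upwards [hb] with t ht z hz
    change ‖z.1‖ ^ 2 + ‖z.2‖ ^ 2 ≤ (j : ℝ) ^ 2 at hz
    exact ht _ _ ((sq_le_sq₀ (norm_nonneg _) (Nat.cast_nonneg j)).1 (by nlinarith [sq_nonneg ‖z.2‖]))
      ((sq_le_sq₀ (norm_nonneg _) (Nat.cast_nonneg j)).1 (by nlinarith [sq_nonneg ‖z.1‖]))
  · rw [mem_singleton_iff.1 hk]
    exact ⟨hm, Eventually.of_forall hm0⟩
  · obtain ⟨δ, hδ, h⟩ := exists_integral_le_of_locallyIntegrable hm (-r) r (half_pos hε)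
    refine ⟨δ, hδ, fun s t hs hst ht hd k hk => ?_⟩
    rw [mem_singleton_iff.1 hk]
    linarith [h s t hs hst ht hd.le]

/-- Solutions of the equations in `E` belong to the sets `K^I_j` of test curves. -/
theorem IsSolutionOn.mem_KSet {E : Set (LC N)} {g : LC N} (hg : g ∈ E) {ψ : Hist N} {S : ℝ}
    {x : ℝ → V N} (hx : IsSolutionOn g ψ S x) {R : ℝ} (hR : ∀ s ∈ Icc (-1) S, ‖x s‖ ≤ R)
    {q₁ q₂ : ℚ} {j : ℕ} (hj : 2 * R ≤ j) (hq₁ : (0 : ℝ) ≤ q₁) (hq₂ : (q₂ : ℝ) ≤ S) :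
    x ∈ KSet N (mBoundModuli E) q₁ q₂ j := by
  refine ⟨hx.1.mono (Icc_subset_Icc (by linarith) hq₂), fun t ht => ?_, ?_⟩
  · have h1 := hR t ⟨by linarith [ht.1], ht.2.trans hq₂⟩
    linarith [norm_nonneg (x t)]
  · have key : ∀ s ∈ Icc (q₁ : ℝ) q₂, ∀ t ∈ Icc (q₁ : ℝ) q₂, s ≤ t →
        edist (x t) (x s) ≤ mBoundModuli E q₁ q₂ j |t - s| := by
      intro s hs t ht hst
      rw [edist_eq_enorm_sub, hx.sub_eq (hq₁.trans hs.1) hst (ht.2.trans hq₂),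
        intervalIntegral.integral_of_le hst, abs_of_nonneg (sub_nonneg.2 hst)]
      refine (enorm_integral_le_lintegral_enorm _).trans ?_
      refine le_trans ?_ (lintegral_optMBound_le_mBoundModuli hg j hs (t - s))
      rw [add_sub_cancel]
      refine (setLIntegral_mono' measurableSet_Ioc fun r hr => ?_).trans
        (lintegral_mono_set Ioc_subset_Icc_self)
      have h1 := hR r ⟨by linarith [hr.1, hs.1], by linarith [hr.2, ht.2]⟩
      have h2 := hR (r - 1) ⟨by linarith [hr.1, hs.1], by linarith [hr.2, ht.2]⟩
      exact enorm_le_optMBound g r (mem_ball2 h1 h2 hj)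
    intro t ht s hs
    rcases le_total s t with h | h
    · exact key s hs t ht h
    · rw [edist_comm, abs_sub_comm]
      exact key t ht s hs h

/-- Bounded solutions of the equations in `E`, with initial data close to `φ`, are
equicontinuous. -/
theorem HasL1LocEquicontinuousMBounds.exists_norm_sub_le {E : Set (LC N)}
    (hE : HasL1LocEquicontinuousMBounds E) (φ : Hist N) (R T : ℝ) {ε : ℝ} (hε : 0 < ε) :
    ∃ η > (0 : ℝ), ∃ δ > (0 : ℝ), ∀ g ∈ E, ∀ ψ : Hist N, dist ψ φ < δ → ∀ S, 0 ≤ S → S ≤ T →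
      ∀ x, IsSolutionOn g ψ S x → (∀ s ∈ Icc (-1) S, ‖x s‖ ≤ R) →
        ∀ s ∈ Icc (-1) S, ∀ t ∈ Icc (-1) S, |t - s| < η → ‖x t - x s‖ ≤ ε := by
  obtain ⟨η₁, hη₁, h₁⟩ := hE.exists_norm_integral_le R T (half_pos hε)
  obtain ⟨η₂, hη₂, h₂⟩ := Metric.uniformContinuous_iff.1
    (CompactSpace.uniformContinuous_of_continuous φ.continuous) (ε / 4) (by positivity)
  refine ⟨min η₁ η₂, lt_min hη₁ hη₂, ε / 8, by positivity, fun g hg ψ hψ S hS hST x hx hR => ?_⟩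
  have hneg : ∀ s t, -1 ≤ s → s ≤ t → t ≤ 0 → t - s < min η₁ η₂ → ‖x t - x s‖ ≤ ε / 2 := by
    intro s t hs hst ht hd
    have hs' : s ∈ Icc (-1 : ℝ) 0 := ⟨hs, hst.trans ht⟩
    have ht' : t ∈ Icc (-1 : ℝ) 0 := ⟨hs.trans hst, ht⟩
    rw [hx.apply_of_mem hs', hx.apply_of_mem ht', ← dist_eq_norm]
    have e1 := ContinuousMap.dist_apply_le_dist (f := ψ) (g := φ) ⟨t, ht'⟩
    have e2 := ContinuousMap.dist_apply_le_dist (f := ψ) (g := φ) ⟨s, hs'⟩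
    have e3 : dist (φ ⟨t, ht'⟩) (φ ⟨s, hs'⟩) < ε / 4 := h₂ (by
      rw [Subtype.dist_eq, Real.dist_eq, abs_of_nonneg (by simpa using hst)]
      exact hd.trans_le (min_le_right _ _))
    have e4 := dist_triangle4 (ψ ⟨t, ht'⟩) (φ ⟨t, ht'⟩) (φ ⟨s, hs'⟩) (ψ ⟨s, hs'⟩)
    rw [dist_comm (φ ⟨s, hs'⟩)] at e4
    linarith
  have hpos : ∀ s t, 0 ≤ s → s ≤ t → t ≤ S → t - s < min η₁ η₂ → ‖x t - x s‖ ≤ ε / 2 := by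
    intro s t hs hst ht hd
    rw [hx.sub_eq hs hst ht]
    exact h₁ g hg x (fun r => x (r - 1)) s t (by linarith) hst (ht.trans hST)
      (hd.trans_le (min_le_left _ _))
      (fun r hr => hR r ⟨by linarith [hr.1], hr.2.trans ht⟩)
      (fun r hr => hR _ ⟨by linarith [hr.1], by linarith [hr.2]⟩)
  have key : ∀ s ∈ Icc (-1) S, ∀ t ∈ Icc (-1) S, s ≤ t → t - s < min η₁ η₂ →
      ‖x t - x s‖ ≤ ε := by
    intro s hs t ht hst hd
    rcases le_total t 0 with h | h
    · linarith [hneg s t hs.1 hst h hd]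
    rcases le_total 0 s with h' | h'
    · linarith [hpos s t h' hst ht.2 hd]
    have e1 := hneg s 0 hs.1 h' le_rfl (by linarith)
    have e2 := hpos 0 t le_rfl h ht.2 (by linarith)
    linarith [norm_sub_le_norm_sub_add_norm_sub (x t) (x 0) (x s)]
  intro s hs t ht hd
  rcases le_total s t with h | h
  · exact key s hs t ht h (by rwa [abs_of_nonneg (sub_nonneg.2 h)] at hd)
  · rw [norm_sub_rev]
    exact key t ht s hs h (by rwa [abs_sub_comm, abs_of_nonneg (sub_nonneg.2 h)] at hd)

/-! ### Monotonicity in the delay: bracketing by constants in `D` -/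

theorem euclidean_norm_le_of_apply {v : V N} {c : ℝ} (hc : 0 ≤ c) (h : ∀ k, |v k| ≤ c) :
    ‖v‖ ≤ N * c := by
  refine (sq_le_sq₀ (norm_nonneg _) (by positivity)).1 ?_
  rw [EuclideanSpace.norm_sq_eq]
  calc ∑ k, ‖v k‖ ^ 2 ≤ ∑ _k : Fin N, c ^ 2 := Finset.sum_le_sum fun k _ =>
        pow_le_pow_left₀ (norm_nonneg _) (h k) 2
    _ = N * c ^ 2 := by simp
    _ ≤ (N * N : ℝ) * c ^ 2 := by
        refine mul_le_mul_of_nonneg_right ?_ (sq_nonneg c)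
        exact_mod_cast Nat.le_mul_self N
    _ = (N * c) ^ 2 := by ring

theorem intervalIntegral_apply {h : ℝ → V N} {a b : ℝ} (hh : IntervalIntegrable h volume a b)
    (k : Fin N) : (∫ r in a..b, h r) k = ∫ r in a..b, h r k :=
  ((EuclideanSpace.proj k : V N →L[ℝ] ℝ).intervalIntegral_comp_comm hh).symm

theorem abs_apply_le_norm (v : V N) (k : Fin N) : |v k| ≤ ‖v‖ := PiLp.norm_apply_le v k

/-- If the delayed argument `w` stays between two constants `d₁ ≤ w ≤ d₂`, the monotonicity of `g`
and the Lipschitz continuity of `f` reduce the comparison of `g` and `f` along `w` to their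
comparison at the constants `d₁` and `d₂`. -/
theorem Ky.norm_integral_sub_le {g : LC N} (hg : Ky g) (f : LC N) {z w : ℝ → V N} {d₁ d₂ : V N}
    {a b R ε δ : ℝ} {l : ℝ → ℝ} (hab : a ≤ b) (hz : ContinuousOn z (Icc a b))
    (hw : ContinuousOn w (Icc a b)) (hzR : ∀ r ∈ Icc a b, ‖z r‖ ≤ R)
    (hwR : ∀ r ∈ Icc a b, ‖w r‖ ≤ R) (hd₁R : ‖d₁‖ ≤ R) (hd₂R : ‖d₂‖ ≤ R)
    (hl : LocallyIntegrable l volume) (hl0 : ∀ t, 0 ≤ l t)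
    (hlb : ∀ᵐ t : ℝ, ∀ a b a' b' : V N, ‖a‖ ≤ R → ‖b‖ ≤ R → ‖a'‖ ≤ R → ‖b'‖ ≤ R →
      ‖f t a b - f t a' b'‖ ≤ l t * (‖a - a'‖ + ‖b - b'‖))
    (hd₁w : ∀ r ∈ Icc a b, ∀ i, d₁ i ≤ w r i) (hwd₂ : ∀ r ∈ Icc a b, ∀ i, w r i ≤ d₂ i)
    (hε : 0 ≤ ε) (hδ : 0 ≤ δ)
    (hd₁ε : ∀ r ∈ Icc a b, ‖d₁ - w r‖ ≤ ε) (hd₂ε : ∀ r ∈ Icc a b, ‖d₂ - w r‖ ≤ ε)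
    (h₁ : ‖∫ r in a..b, (g r (z r) d₁ - f r (z r) d₁)‖ ≤ δ)
    (h₂ : ‖∫ r in a..b, (g r (z r) d₂ - f r (z r) d₂)‖ ≤ δ) :
    ‖∫ r in a..b, (g r (z r) (w r) - f r (z r) (w r))‖ ≤ N * (δ + ε * ∫ r in a..b, l r) := by
  have hli := locallyIntegrable_intervalIntegrable hl a b
  have hL0 : 0 ≤ ∫ r in a..b, l r := intervalIntegral.integral_nonneg hab fun t _ => hl0 t
  have hi : ∀ v : ℝ → V N, ContinuousOn v (Icc a b) →
      IntervalIntegrable (fun r => g r (z r) (v r) - f r (z r) (v r)) volume a b := fun v hv =>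
    (g.intervalIntegrable hab hz hv).sub (f.intervalIntegrable hab hz hv)
  have hik : ∀ v : ℝ → V N, ContinuousOn v (Icc a b) → ∀ k,
      IntervalIntegrable (fun r => (g r (z r) (v r) - f r (z r) (v r)) k) volume a b :=
    fun v hv k => by
      have := hi v hv
      rw [intervalIntegrable_iff_integrableOn_Icc_of_le hab] at this ⊢
      exact (EuclideanSpace.proj k : V N →L[ℝ] ℝ).integrable_comp this
  have hdi : ∀ d : V N, ‖∫ r in a..b, (g r (z r) d - f r (z r) d)‖ ≤ δ → ∀ k,
      |∫ r in a..b, (g r (z r) d - f r (z r) d) k| ≤ δ := fun d hd k => by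
    rw [← intervalIntegral_apply (hi (fun _ => d) continuousOn_const)]
    exact (abs_apply_le_norm _ k).trans hd
  refine euclidean_norm_le_of_apply (by positivity) fun k => ?_
  rw [intervalIntegral_apply (hi w hw)]
  have hae : ∀ᵐ r ∂(volume.restrict (Icc a b)),
      (g r (z r) d₁ - f r (z r) d₁) k - l r * ε ≤ (g r (z r) (w r) - f r (z r) (w r)) k ∧
      (g r (z r) (w r) - f r (z r) (w r)) k ≤ (g r (z r) d₂ - f r (z r) d₂) k + l r * ε := by
    filter_upwards [ae_restrict_of_ae hg.ae, ae_restrict_of_ae hlb,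
      ae_restrict_mem measurableSet_Icc] with r hgr hlr hr
    have e1 := hgr (z r) d₁ (w r) (hd₁w r hr) k
    have e2 := hgr (z r) (w r) d₂ (hwd₂ r hr) k
    have e3 : ∀ d : V N, ‖d‖ ≤ R → ‖d - w r‖ ≤ ε →
        |(f r (z r) d - f r (z r) (w r)) k| ≤ l r * ε := fun d hd hdε => by
      refine (abs_apply_le_norm _ k).trans
        ((hlr _ _ _ _ (hzR r hr) hd (hzR r hr) (hwR r hr)).trans ?_)
      rw [sub_self, norm_zero, zero_add]
      exact mul_le_mul_of_nonneg_left hdε (hl0 r)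
    have e4 := abs_le.1 (e3 d₁ hd₁R (hd₁ε r hr))
    have e5 := abs_le.1 (e3 d₂ hd₂R (hd₂ε r hr))
    simp only [PiLp.sub_apply] at e4 e5 ⊢
    exact ⟨by linarith [e4.1], by linarith [e5.2]⟩
  have hup : ∫ r in a..b, (g r (z r) (w r) - f r (z r) (w r)) k ≤
      (∫ r in a..b, (g r (z r) d₂ - f r (z r) d₂) k) + (∫ r in a..b, l r) * ε := by
    rw [← intervalIntegral.integral_mul_const, ← intervalIntegral.integral_add
      (hik (fun _ => d₂) continuousOn_const k) (hli.mul_const _)]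
    exact intervalIntegral.integral_mono_ae_restrict hab (hik w hw k)
      ((hik (fun _ => d₂) continuousOn_const k).add (hli.mul_const _)) (hae.mono fun _ h => h.2)
  have hlow : (∫ r in a..b, (g r (z r) d₁ - f r (z r) d₁) k) - (∫ r in a..b, l r) * ε ≤
      ∫ r in a..b, (g r (z r) (w r) - f r (z r) (w r)) k := by
    rw [← intervalIntegral.integral_mul_const, ← intervalIntegral.integral_sub
      (hik (fun _ => d₁) continuousOn_const k) (hli.mul_const _)]
    exact intervalIntegral.integral_mono_ae_restrict hab
      ((hik (fun _ => d₁) continuousOn_const k).sub (hli.mul_const _)) (hik w hw k)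
      (hae.mono fun _ h => h.1)
  have e1 := abs_le.1 (hdi d₁ h₁ k)
  have e2 := abs_le.1 (hdi d₂ h₂ k)
  rw [abs_le]
  constructor <;> linarith [e1.1, e2.2]

theorem exists_mem_dense_lt {D : Set (V N)} (hD : Dense D) (q : V N) {ε : ℝ} (hε : 0 < ε) :
    (∃ d ∈ D, (∀ i, d i < q i) ∧ dist d q < ε) ∧ ∃ d ∈ D, (∀ i, q i < d i) ∧ dist d q < ε := by
  set e : V N := WithLp.toLp 2 fun _ => 1 with he
  set c : ℝ := ε / (2 * (‖e‖ + 1)) with hc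
  have hc0 : 0 < c := by positivity
  have hce : ‖c • e‖ < ε := by
    rw [norm_smul, Real.norm_of_nonneg hc0.le, hc, div_mul_eq_mul_div, div_lt_iff₀ (by positivity)]
    nlinarith [norm_nonneg e]
  have hopen₁ : IsOpen {d : V N | (∀ i, d i < q i) ∧ dist d q < ε} := by
    simp only [Set.ofPred_and, Set.ofPred_forall]
    exact (isOpen_iInter_of_finite fun i => isOpen_lt (by fun_prop) continuous_const).inter
      (isOpen_lt (by fun_prop) continuous_const)
  have hopen₂ : IsOpen {d : V N | (∀ i, q i < d i) ∧ dist d q < ε} := by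
    simp only [Set.ofPred_and, Set.ofPred_forall]
    exact (isOpen_iInter_of_finite fun i => isOpen_lt continuous_const (by fun_prop)).inter
      (isOpen_lt (by fun_prop) continuous_const)
  obtain ⟨d₁, h₁, h₁'⟩ := hD.exists_mem_open hopen₁ ⟨q - c • e, fun i => by simp [he, hc0], by
    simpa [dist_eq_norm] using hce⟩
  obtain ⟨d₂, h₂, h₂'⟩ := hD.exists_mem_open hopen₂ ⟨q + c • e, fun i => by simp [he, hc0], by
    simpa [dist_eq_norm] using hce⟩
  exact ⟨⟨d₁, h₁, h₁'⟩, ⟨d₂, h₂, h₂'⟩⟩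

/-- Finitely many pairs of points of `D` suffice to bracket tightly all small subsets of a ball. -/
theorem exists_finset_bracketing {D : Set (V N)} (hD : Dense D) (R : ℝ) {ε : ℝ} (hε : 0 < ε) :
    ∃ F : Finset (D × D), ∃ η > (0 : ℝ), ∀ p : V N, ‖p‖ ≤ R → ∃ d ∈ F, ∀ q, dist q p < η →
      (∀ i, (d.1 : V N) i ≤ q i) ∧ (∀ i, q i ≤ (d.2 : V N) i) ∧ ‖(d.1 : V N) - q‖ ≤ ε ∧
        ‖(d.2 : V N) - q‖ ≤ ε := by
  let c : D × D → Set (V N) := fun d => {q | (∀ i, (d.1 : V N) i < q i) ∧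
    (∀ i, q i < (d.2 : V N) i) ∧ dist (d.1 : V N) q < ε ∧ dist (d.2 : V N) q < ε}
  have hc : ∀ d, IsOpen (c d) := fun d => by
    simp only [c, Set.ofPred_and, Set.ofPred_forall]
    exact (isOpen_iInter_of_finite fun i => isOpen_lt continuous_const (by fun_prop)).inter
      ((isOpen_iInter_of_finite fun i => isOpen_lt (by fun_prop) continuous_const).inter
        ((isOpen_lt (by fun_prop) continuous_const).inter
          (isOpen_lt (by fun_prop) continuous_const)))
  have hcov : Metric.closedBall (0 : V N) R ⊆ ⋃ d, c d := fun q _ => by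
    obtain ⟨⟨d₁, h₁, h₁', h₁''⟩, ⟨d₂, h₂, h₂', h₂''⟩⟩ := exists_mem_dense_lt hD q hε
    exact mem_iUnion.2 ⟨(⟨d₁, h₁⟩, ⟨d₂, h₂⟩), h₁', h₂', h₁'', h₂''⟩
  obtain ⟨F, hF⟩ := (isCompact_closedBall (0 : V N) R).elim_finite_subcover c hc hcov
  obtain ⟨η, hη, h⟩ := lebesgue_number_lemma_of_metric (ι := F) (c := fun d => c d.1)
    (isCompact_closedBall (0 : V N) R) (fun d => hc d) (by simpa [iUnion_subtype] using hF)
  refine ⟨F, η, hη, fun p hp => ?_⟩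
  obtain ⟨d, hd⟩ := h p (by simpa using hp)
  refine ⟨d, d.2, fun q hq => ?_⟩
  have := hd (Metric.mem_ball.2 hq)
  exact ⟨fun i => (this.1 i).le, fun i => (this.2.1 i).le,
    by simpa [dist_eq_norm] using this.2.2.1.le, by simpa [dist_eq_norm] using this.2.2.2.le⟩

/-! ### Convergence of the right-hand sides along solutions -/

/-- If `g ∈ E` is close to `f` in the weak topology, then the integrals of `g` and `f` along the
bounded solutions of the equation given by `g` are close. The time axis is divided into rational
cells on which the delayed term oscillates little; on each cell it is bracketed by two points
of `D`. The incomplete last cell is dealt with by the `m`-bounds. -/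
theorem exists_eventually_norm_integral_sub_le {E : Set (LC N)}
    (hE : HasL1LocEquicontinuousMBounds E) (hKy : ∀ f ∈ E, Ky f) {D : Set (V N)} (hD : Dense D)
    (f : LC N) (φ : Hist N) {R T : ℝ} (hT : 0 ≤ T) {ε : ℝ} (hε : 0 < ε) :
    ∃ δ > (0 : ℝ), ∀ᶠ g in @nhds _ (sigmaTop (mBoundModuli E) D) f, g ∈ E → ∀ ψ : Hist N,
      dist ψ φ < δ → ∀ S, 0 ≤ S → S ≤ T → ∀ x, IsSolutionOn g ψ S x →
        (∀ s ∈ Icc (-1) S, ‖x s‖ ≤ R) → ∀ s ∈ Icc 0 S,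
          ‖∫ r in 0..s, (g r (x r) (x (r - 1)) - f r (x r) (x (r - 1)))‖ ≤ ε := by
  obtain ⟨l, hl, hl0, hlb⟩ := f.exists_lipschitz (R + 1)
  have hli := locallyIntegrable_intervalIntegrable hl
  set L := ∫ r in 0..T, l r with hL
  have hL0 : 0 ≤ L := intervalIntegral.integral_nonneg hT fun t _ => hl0 t
  set ε₁ : ℝ := min 1 (ε / (4 * (N + 1) * (L + 1))) with hε₁
  have hε₁0 : 0 < ε₁ := lt_min one_pos (by positivity)
  -- the brackets `d₁ ≤ w ≤ d₂` have width `ε₁`, which costs at most `N * ε₁ * L ≤ ε / 4` in all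
  obtain ⟨F, ε₀, hε₀, hF⟩ := exists_finset_bracketing hD R hε₁0
  obtain ⟨η, hη, δ, hδ, hequi⟩ := hE.exists_norm_sub_le φ R T (half_pos hε₀)
  obtain ⟨ηg, hηg, hsmallg⟩ := hE.exists_norm_integral_le R T (ε := ε / 8) (by positivity)
  obtain ⟨ηf, hηf, hsmallf⟩ := (hasL1LocEquicontinuousMBounds_singleton f).exists_norm_integral_le
    R T (ε := ε / 8) (by positivity)
  obtain ⟨M', hM'⟩ := exists_nat_one_div_lt (lt_min hη (lt_min hηg hηf))
  set M : ℕ := M' + 1 with hMM'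
  have hM0 : (0 : ℝ) < M := by positivity
  have hM : (1 : ℝ) / M < min η (min ηg ηf) := by simpa [hMM'] using hM'
  have hMη : (1 : ℝ) / M < η := hM.trans_le (min_le_left _ _)
  have hMηg : (1 : ℝ) / M < ηg := hM.trans_le ((min_le_right _ _).trans (min_le_left _ _))
  have hMηf : (1 : ℝ) / M < ηf := hM.trans_le ((min_le_right _ _).trans (min_le_right _ _))
  obtain ⟨K, hK⟩ := exists_nat_ge (T * M)
  -- at most `K` cells are needed, and each may contribute `N * δ₂` through the seminorms
  set δ₂ : ℝ := ε / (4 * (N + 1) * (K + 1)) with hδ₂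
  have hδ₂0 : 0 < δ₂ := by positivity
  obtain ⟨j, hj⟩ := exists_nat_ge (2 * R)
  have hcell : ∀ i : ℕ, (i : ℚ) / M < ((i : ℚ) + 1) / M := fun i => by
    have : (0 : ℚ) < M := by exact_mod_cast hM0
    gcongr
    linarith
  let idx : ℕ → D → Idx D := fun i d => ⟨⟨((i : ℚ) / M, ((i : ℚ) + 1) / M), hcell i⟩, d, j⟩
  refine ⟨δ, hδ, ?_⟩
  have hev : ∀ᶠ g in @nhds _ (sigmaTop (mBoundModuli E) D) f, ∀ i ∈ Finset.range K, ∀ d ∈ F,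
      weakDist (mBoundModuli E) D (idx i d.1) g f < ENNReal.ofReal δ₂ ∧
      weakDist (mBoundModuli E) D (idx i d.2) g f < ENNReal.ofReal δ₂ := by
    rw [Filter.eventually_all_finset]
    intro i _
    rw [Filter.eventually_all_finset]
    intro d _
    exact (eventually_weakDist_lt _ _ _ _ (ENNReal.ofReal_pos.2 hδ₂0)).and
      (eventually_weakDist_lt _ _ _ _ (ENNReal.ofReal_pos.2 hδ₂0))
  filter_upwards [hev] with g hg hgE ψ hψ S hS hST x hx hxR s hs
  have hig : ∀ c d, 0 ≤ c → c ≤ d → d ≤ S →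
      IntervalIntegrable (fun r => g r (x r) (x (r - 1))) volume c d :=
    fun c d => hx.intervalIntegrable_comp g
  have hif : ∀ c d, 0 ≤ c → c ≤ d → d ≤ S →
      IntervalIntegrable (fun r => f r (x r) (x (r - 1))) volume c d :=
    fun c d => hx.intervalIntegrable_comp f
  have hsum : ∀ i : ℕ, (i : ℝ) / M ≤ s →
      ‖∫ r in 0..((i : ℝ) / M), (g r (x r) (x (r - 1)) - f r (x r) (x (r - 1)))‖ ≤
        N * (i * δ₂ + ε₁ * ∫ r in 0..((i : ℝ) / M), l r) := by
    intro i
    induction i with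
    | zero => intro _; simp
    | succ i ih =>
      intro hi
      push_cast at hi ⊢
      have hle : (i : ℝ) / M ≤ ((i : ℝ) + 1) / M := by gcongr; linarith
      have hi0 : 0 ≤ (i : ℝ) / M := by positivity
      have hiS : ((i : ℝ) + 1) / M ≤ S := hi.trans hs.2
      have hlen : ((i : ℝ) + 1) / M - (i : ℝ) / M < η := by
        rw [← sub_div]; simpa using hMη
      have hiK : i ∈ Finset.range K := by
        rw [Finset.mem_range]
        rw [div_le_iff₀ hM0] at hi
        have : ((i : ℝ) + 1) ≤ K := hi.trans ((mul_le_mul_of_nonneg_right (hs.2.trans hST)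
          hM0.le).trans hK)
        exact_mod_cast this
      have hwin : ∀ r ∈ Icc ((i : ℝ) / M) (((i : ℝ) + 1) / M), r - 1 ∈ Icc (-1) S :=
        fun r hr => ⟨by linarith [hr.1], by linarith [hr.2]⟩
      have hzin : ∀ r ∈ Icc ((i : ℝ) / M) (((i : ℝ) + 1) / M), r ∈ Icc (-1) S :=
        fun r hr => ⟨by linarith [hr.1], by linarith [hr.2]⟩
      have hi_mem : (i : ℝ) / M ∈ Icc ((i : ℝ) / M) (((i : ℝ) + 1) / M) := ⟨le_rfl, hle⟩
      obtain ⟨d, hdF, hd⟩ := hF (x ((i : ℝ) / M - 1)) (hxR _ (hwin _ hi_mem))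
      have hosc : ∀ r ∈ Icc ((i : ℝ) / M) (((i : ℝ) + 1) / M),
          dist (x (r - 1)) (x ((i : ℝ) / M - 1)) < ε₀ := fun r hr => by
        rw [dist_eq_norm]
        refine (hequi g hgE ψ hψ S hS hST x hx hxR _ (hwin _ hi_mem) _ (hwin r hr) ?_).trans_lt
          (half_lt_self hε₀)
        rw [abs_of_nonneg (by linarith [hr.1])]
        linarith [hr.2]
      have hdR : ∀ d' : V N, ‖d' - x ((i : ℝ) / M - 1)‖ ≤ ε₁ → ‖d'‖ ≤ R + 1 := fun d' hd' => by
        have e1 := norm_sub_norm_le d' (x ((i : ℝ) / M - 1))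
        linarith [hxR _ (hwin _ hi_mem), min_le_left 1 (ε / (4 * (N + 1) * (L + 1)))]
      have hx0 := hd _ (hosc _ hi_mem)
      have hKmem : x ∈ KSet N (mBoundModuli E) ((i : ℚ) / M) (((i : ℚ) + 1) / M) j :=
        hx.mem_KSet hgE hxR hj (by push_cast; exact hi0) (by push_cast; exact hiS)
      obtain ⟨hw₁, hw₂⟩ := hg i hiK d hdF
      have hc₁ := norm_integral_sub_le_of_weakDist_lt hδ₂0.le hw₁ hKmem
      have hc₂ := norm_integral_sub_le_of_weakDist_lt hδ₂0.le hw₂ hKmem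
      simp only [idx] at hc₁ hc₂
      push_cast at hc₁ hc₂
      have hcellb := (hKy g hgE).norm_integral_sub_le f hle (hx.1.mono fun r hr => hzin r hr)
        (hx.continuousOn_delay.mono (Icc_subset_Icc hi0 hiS))
        (fun r hr => (hxR r (hzin r hr)).trans (by linarith))
        (fun r hr => (hxR _ (hwin r hr)).trans (by linarith)) (hdR _ hx0.2.2.1) (hdR _ hx0.2.2.2)
        hl hl0 hlb (fun r hr => (hd _ (hosc r hr)).1) (fun r hr => (hd _ (hosc r hr)).2.1)
        hε₁0.le hδ₂0.le (fun r hr => (hd _ (hosc r hr)).2.2.1)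
        (fun r hr => (hd _ (hosc r hr)).2.2.2) hc₁ hc₂
      rw [← intervalIntegral.integral_add_adjacent_intervals
        ((hig 0 _ le_rfl hi0 (hle.trans hiS)).sub (hif 0 _ le_rfl hi0 (hle.trans hiS)))
        ((hig _ _ hi0 hle hiS).sub (hif _ _ hi0 hle hiS)),
        ← intervalIntegral.integral_add_adjacent_intervals (hli 0 ((i : ℝ) / M)) (hli _ _)]
      refine (norm_add_le _ _).trans ((add_le_add (ih (hle.trans hi)) hcellb).trans (le_of_eq ?_))
      ring
  set k : ℕ := ⌊s * M⌋₊ with hk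
  have hsM : 0 ≤ s * M := mul_nonneg hs.1 hM0.le
  have hks : (k : ℝ) / M ≤ s := by
    rw [div_le_iff₀ hM0]
    exact Nat.floor_le hsM
  have hsk : s - (k : ℝ) / M < 1 / M := by
    rw [sub_lt_iff_lt_add, ← add_div, lt_div_iff₀ hM0, add_comm]
    exact Nat.lt_floor_add_one _
  have hk0 : 0 ≤ (k : ℝ) / M := by positivity
  have hzR : ∀ r ∈ Icc ((k : ℝ) / M) s, ‖x r‖ ≤ R :=
    fun r hr => hxR r ⟨by linarith [hr.1], hr.2.trans hs.2⟩
  have hwR : ∀ r ∈ Icc ((k : ℝ) / M) s, ‖x (r - 1)‖ ≤ R :=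
    fun r hr => hxR _ ⟨by linarith [hr.1], by linarith [hr.2, hs.2]⟩
  have hg1 := hsmallg g hgE x (fun r => x (r - 1)) ((k : ℝ) / M) s (by linarith) hks
    (hs.2.trans hST) (hsk.trans hMηg) hzR hwR
  have hf1 := hsmallf f rfl x (fun r => x (r - 1)) ((k : ℝ) / M) s (by linarith) hks
    (hs.2.trans hST) (hsk.trans hMηf) hzR hwR
  have hlast : ‖∫ r in ((k : ℝ) / M)..s, (g r (x r) (x (r - 1)) - f r (x r) (x (r - 1)))‖ ≤
      ε / 4 := by
    rw [intervalIntegral.integral_sub (hig _ _ hk0 hks hs.2) (hif _ _ hk0 hks hs.2)]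
    linarith [norm_sub_le (∫ r in ((k : ℝ) / M)..s, g r (x r) (x (r - 1)))
      (∫ r in ((k : ℝ) / M)..s, f r (x r) (x (r - 1)))]
  have hkK : (k : ℝ) ≤ K := by
    rw [div_le_iff₀ hM0] at hks
    exact hks.trans ((mul_le_mul_of_nonneg_right (hs.2.trans hST) hM0.le).trans hK)
  have hlk : ∫ r in 0..((k : ℝ) / M), l r ≤ L :=
    intervalIntegral.integral_mono_interval le_rfl hk0 (hks.trans (hs.2.trans hST))
      (Eventually.of_forall hl0) (hli _ _)
  have hfull : N * (k * δ₂ + ε₁ * ∫ r in 0..((k : ℝ) / M), l r) ≤ ε / 2 := by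
    have e1 : N * (k * δ₂) ≤ ε / 4 := by
      calc N * (k * δ₂) ≤ (N + 1) * ((K + 1) * δ₂) := by gcongr <;> linarith
        _ = ε / 4 := by rw [hδ₂]; field_simp
    have e2 : N * (ε₁ * ∫ r in 0..((k : ℝ) / M), l r) ≤ ε / 4 := by
      calc N * (ε₁ * ∫ r in 0..((k : ℝ) / M), l r)
          ≤ (N + 1) * (ε / (4 * (N + 1) * (L + 1)) * (L + 1)) := by
            have h0 : 0 ≤ ∫ r in 0..((k : ℝ) / M), l r :=
              intervalIntegral.integral_nonneg hk0 fun t _ => hl0 t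
            gcongr
            · linarith
            · exact min_le_right _ _
            · linarith
        _ = ε / 4 := by field_simp
    linarith
  rw [← intervalIntegral.integral_add_adjacent_intervals
    ((hig 0 _ le_rfl hk0 (hks.trans hs.2)).sub (hif 0 _ le_rfl hk0 (hks.trans hs.2)))
    ((hig _ _ hk0 hks hs.2).sub (hif _ _ hk0 hks hs.2))]
  linarith [norm_add_le (∫ r in 0..((k : ℝ) / M), (g r (x r) (x (r - 1)) - f r (x r) (x (r - 1))))
    (∫ r in ((k : ℝ) / M)..s, (g r (x r) (x (r - 1)) - f r (x r) (x (r - 1)))), hsum k hks]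

/-! ### Continuous dependence of the solutions -/

/-- Continuous dependence for the equations in `E`. A solution of the perturbed equation cannot
leave the `ε`-neighbourhood of the given solution, since up to the first exit time it is bounded and
the Grönwall inequality applies; hence it cannot blow up either. -/
theorem exists_eventually_norm_sol_sub_le {E : Set (LC N)}
    (hE : HasL1LocEquicontinuousMBounds E) (hKy : ∀ f ∈ E, Ky f) {D : Set (V N)} (hD : Dense D)
    {f : LC N} {φ : Hist N} {T : ℝ} (hT : 0 ≤ T) (hTf : T ∈ maxInterval f φ) {ε : ℝ}
    (hε : 0 < ε) :
    ∃ δ > (0 : ℝ), ∀ᶠ g in @nhds _ (sigmaTop (mBoundModuli E) D) f, g ∈ E → ∀ ψ : Hist N,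
      dist ψ φ < δ → T ∈ maxInterval g ψ ∧ ∀ t ∈ Icc (-1) T, ‖sol g ψ t - sol f φ t‖ ≤ ε := by
  have hsolf := (mem_maxInterval_iff hT).1 hTf
  set x := sol f φ with hxdef
  obtain ⟨R₀, hR₀, hxR₀⟩ := hsolf.exists_norm_le
  set R := R₀ + ε with hR
  obtain ⟨l, hl, hl0, hlb⟩ := f.exists_lipschitz R
  have hli := locallyIntegrable_intervalIntegrable hl
  obtain ⟨C, hC, hG⟩ := exists_delay_gronwall hl hl0 hT
  set ε₂ : ℝ := ε / (4 * (C + 1)) with hε₂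
  have hε₂0 : 0 < ε₂ := by positivity
  have hε₂ε : ε₂ < ε := by
    rw [hε₂, div_lt_iff₀ (by positivity)]
    nlinarith
  have hCε₂ : C * (ε₂ + ε₂) ≤ ε / 2 := by
    have : (C + 1) * (ε₂ + ε₂) = ε / 2 := by rw [hε₂]; field_simp; norm_num
    nlinarith
  obtain ⟨δ, hδ, hev⟩ := exists_eventually_norm_integral_sub_le hE hKy hD f φ (R := R) hT hε₂0
  refine ⟨min δ ε₂, lt_min hδ hε₂0, ?_⟩
  filter_upwards [hev] with g hg hgE ψ hψ
  have hψδ : dist ψ φ < δ := hψ.trans_le (min_le_left _ _)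
  have hneg : ∀ (S : ℝ) z, IsSolutionOn g ψ S z → ∀ s ∈ Icc (-1 : ℝ) 0, ‖z s - x s‖ ≤ ε₂ := by
    intro S z hz s hs
    rw [hz.apply_of_mem hs, hsolf.apply_of_mem hs, ← dist_eq_norm]
    exact (ContinuousMap.dist_apply_le_dist _).trans (hψ.le.trans (min_le_right _ _))
  -- the a priori estimate, as long as the perturbed solution stays `ε`-close
  have hapriori : ∀ S, 0 ≤ S → S ≤ T → ∀ z, IsSolutionOn g ψ S z →
      (∀ s ∈ Icc (-1) S, ‖z s - x s‖ ≤ ε) → ∀ s ∈ Icc (-1) S, ‖z s - x s‖ ≤ ε / 2 := by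
    intro S hS hST z hz hclose s hs
    have hxS := hsolf.mono hST
    have hxR : ∀ s ∈ Icc (-1) S, ‖x s‖ ≤ R := fun s hs =>
      (hxR₀ s ⟨hs.1, hs.2.trans hST⟩).trans (by linarith)
    have hzR : ∀ s ∈ Icc (-1) S, ‖z s‖ ≤ R := fun s hs => by
      have := norm_sub_norm_le (z s) (x s)
      linarith [hclose s hs, hxR₀ s ⟨hs.1, hs.2.trans hST⟩]
    have herr := hg hgE ψ hψδ S hS hST z hz hzR
    have hcont : ContinuousOn (fun s => ‖z s - x s‖) (Icc (-1) S) := (hz.1.sub hxS.1).norm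
    refine (hG S (ε₂ + ε₂) (fun s => ‖z s - x s‖) hST (by positivity) hcont
      (fun _ _ => norm_nonneg _) (fun s hs => (hneg S z hz s hs).trans (by linarith))
      (fun s hs => ?_) s hs).trans hCε₂
    have hi1 := hz.intervalIntegrable_comp g le_rfl hs.1 hs.2
    have hi2 := hz.intervalIntegrable_comp f le_rfl hs.1 hs.2
    have hi3 := hxS.intervalIntegrable_comp f le_rfl hs.1 hs.2
    have hsplit : z s - x s = (ψ ⟨0, by norm_num⟩ - φ ⟨0, by norm_num⟩) +
        ((∫ r in 0..s, (g r (z r) (z (r - 1)) - f r (z r) (z (r - 1)))) +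
          ∫ r in 0..s, (f r (z r) (z (r - 1)) - f r (x r) (x (r - 1)))) := by
      rw [hz.2.2 s hs, hxS.2.2 s hs, intervalIntegral.integral_sub hi1 hi2,
        intervalIntegral.integral_sub hi2 hi3]
      abel
    have hlast : ‖∫ r in 0..s, (f r (z r) (z (r - 1)) - f r (x r) (x (r - 1)))‖ ≤
        ∫ r in 0..s, l r * (‖z r - x r‖ + ‖z (r - 1) - x (r - 1)‖) := by
      refine intervalIntegral.norm_integral_le_of_norm_le hs.1 ?_ ?_
      · filter_upwards [hlb] with r hr hrs
        have h1 : r ∈ Icc (-1) S := ⟨by linarith [hrs.1], hrs.2.trans hs.2⟩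
        have h2 : r - 1 ∈ Icc (-1) S := ⟨by linarith [hrs.1], by linarith [hrs.2, hs.2]⟩
        exact hr _ _ _ _ (hzR _ h1) (hzR _ h2) (hxR _ h1) (hxR _ h2)
      · refine (hli _ _).mul_continuousOn ?_
        rw [uIcc_of_le hs.1]
        exact (hcont.mono (Icc_subset_Icc (by linarith) hs.2)).add (hcont.comp (by fun_prop)
          fun r hr => ⟨by linarith [hr.1], by linarith [hr.2, hs.2]⟩)
    have hψ0 : ‖ψ ⟨0, by norm_num⟩ - φ ⟨0, by norm_num⟩‖ ≤ ε₂ := by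
      have := hneg S z hz 0 (by norm_num)
      rwa [hz.apply_of_mem (by norm_num), hsolf.apply_of_mem (by norm_num)] at this
    have e1 := herr s hs
    rw [hsplit]
    refine (norm_add_le _ _).trans ?_
    have e2 := norm_add_le (∫ r in 0..s, (g r (z r) (z (r - 1)) - f r (z r) (z (r - 1))))
      (∫ r in 0..s, (f r (z r) (z (r - 1)) - f r (x r) (x (r - 1))))
    linarith
  -- a first exit time leads to a contradiction
  have hstay : ∀ S, 0 ≤ S → S ≤ T → ∀ z, IsSolutionOn g ψ S z →
      ∀ s ∈ Icc (-1) S, ‖z s - x s‖ ≤ ε := by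
    intro S hS hST z hz
    have hxS := hsolf.mono hST
    have hcont : ContinuousOn (fun s => ‖z s - x s‖) (Icc (-1) S) := (hz.1.sub hxS.1).norm
    by_contra! hex
    obtain ⟨s₁, hs₁, hs₁ε⟩ := hex
    have hcomp : IsCompact (Icc (-1) S ∩ (fun s => ‖z s - x s‖) ⁻¹' Ici ε) :=
      isCompact_Icc.of_isClosed_subset (hcont.preimage_isClosed_of_isClosed isClosed_Icc
        isClosed_Ici) inter_subset_left
    obtain ⟨p, ⟨hpS, hpε⟩, hpmin⟩ := hcomp.exists_isLeast ⟨s₁, hs₁, hs₁ε.le⟩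
    have hpε : ε ≤ ‖z p - x p‖ := hpε
    have hp0 : 0 ≤ p := by
      by_contra! hp
      linarith [hneg S z hz p ⟨hpS.1, hp.le⟩]
    have hbefore : ∀ s ∈ Icc (-1) p, ‖z s - x s‖ ≤ ε := by
      intro s hs
      by_contra! hsε
      have h1 : ‖z (-1) - x (-1)‖ ≤ ε := (hneg S z hz (-1) (by norm_num)).trans hε₂ε.le
      obtain ⟨q, hq, hqε⟩ := intermediate_value_Icc hs.1
        (hcont.mono (Icc_subset_Icc le_rfl (hs.2.trans hpS.2))) ⟨h1, hsε.le⟩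
      have hpq : p ≤ q := hpmin ⟨⟨hq.1, hq.2.trans (hs.2.trans hpS.2)⟩, hqε.ge⟩
      have : q = s := le_antisymm hq.2 (hs.2.trans hpq)
      rw [this] at hqε
      exact hsε.ne' hqε
    linarith [hapriori p hp0 (hpS.2.trans hST) z (hz.mono hpS.2) hbefore p ⟨by linarith, le_rfl⟩]
  have hTg : T ∈ maxInterval g ψ := by
    by_contra hTg
    obtain ⟨t, ht0, htT, htI, ht⟩ := exists_lt_norm_sol hTg hT (R₀ + ε)
    have h1 := hstay t ht0 htT.le _ ((mem_maxInterval_iff ht0).1 htI) t ⟨by linarith, le_rfl⟩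
    have h2 := hxR₀ t ⟨by linarith, htT.le⟩
    linarith [norm_sub_norm_le (sol g ψ t) (x t)]
  exact ⟨hTg, hstay T hT le_rfl _ ((mem_maxInterval_iff hT).1 hTg)⟩

/-- Continuous dependence for the equations in the closure of `E`: they are approximated by
equations in `E`, whose solutions stay close to the given one. -/
theorem exists_eventually_closure_norm_sol_sub_le {E : Set (LC N)}
    (hE : HasL1LocEquicontinuousMBounds E) (hKy : ∀ f ∈ E, Ky f) {D : Set (V N)} (hD : Dense D)
    {τ : TopologicalSpace (LC N)}
    (hτ : ∀ f, @nhds _ τ f ≤ @nhds _ (sigmaTop (mBoundModuli E) D) f)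
    {f : LC N} {φ : Hist N} {T : ℝ} (hT : 0 ≤ T) (hTf : T ∈ maxInterval f φ) {ε : ℝ}
    (hε : 0 < ε) :
    ∃ δ > (0 : ℝ), ∀ᶠ g in 𝓝 f, g ∈ closure E → ∀ ψ : Hist N,
      dist ψ φ < δ → T ∈ maxInterval g ψ ∧ ∀ t ∈ Icc (-1) T, ‖sol g ψ t - sol f φ t‖ ≤ ε := by
  obtain ⟨δ, hδ, hev⟩ := exists_eventually_norm_sol_sub_le hE hKy hD hT hTf hε
  have hsolf := (mem_maxInterval_iff hT).1 hTf
  obtain ⟨R₀, hR₀, hxR₀⟩ := hsolf.exists_norm_le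
  refine ⟨δ, hδ, ?_⟩
  filter_upwards [(hev.filter_mono (hτ f)).eventually_nhds] with g hg hgE ψ hψ
  -- compare `g` with some `k ∈ E` that is close to `g` and, like `g`, close to `f`
  have happrox : ∀ t, 0 ≤ t → t ≤ T → t ∈ maxInterval g ψ → ∀ s ∈ Icc (-1) t,
      ∀ ε' > (0 : ℝ), ‖sol g ψ s - sol f φ s‖ ≤ ε + ε' := by
    intro t ht htT htI s hs ε' hε'
    obtain ⟨δ', hδ', hev'⟩ := exists_eventually_norm_sol_sub_le hE hKy hD ht htI hε'
    obtain ⟨k, hkE, hk1, hk2⟩ := ((mem_closure_iff_frequently.1 hgE).and_eventually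
      (hg.and (hev'.filter_mono (hτ g)))).exists
    have h1 := (hk1 hkE ψ hψ).2 s ⟨hs.1, hs.2.trans htT⟩
    have h2 := (hk2 hkE ψ (by simpa using hδ')).2 s hs
    rw [norm_sub_rev] at h2
    linarith [norm_sub_le_norm_sub_add_norm_sub (sol g ψ s) (sol k ψ s) (sol f φ s)]
  have hTg : T ∈ maxInterval g ψ := by
    by_contra hTg
    obtain ⟨t, ht0, htT, htI, ht⟩ := exists_lt_norm_sol hTg hT (R₀ + ε + 1)
    have h1 := happrox t ht0 htT.le htI t ⟨by linarith, le_rfl⟩ 1 one_pos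
    have h2 := hxR₀ t ⟨by linarith, htT.le⟩
    linarith [norm_sub_norm_le (sol g ψ t) (sol f φ t)]
  exact ⟨hTg, fun t ht => le_of_forall_pos_le_add (happrox T hT le_rfl hTg t ht)⟩

/-- Convergence of the solutions under convergence of the equations in the weak topology. -/
theorem tendstoUniformlyOn_sol {E : Set (LC N)}
    (hE : HasL1LocEquicontinuousMBounds E) (hKy : ∀ f ∈ E, Ky f) {D : Set (V N)} (hD : Dense D)
    {φ : Hist N} {φn : ℕ → Hist N} {f : LC N} {fn : ℕ → LC N} (hφ : Tendsto φn atTop (𝓝 φ))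
    (hfn : ∀ n, fn n ∈ E)
    (hf : Tendsto fn atTop (@nhds _ (sigmaTop (mBoundModuli E) D) f)) {T : ℝ}
    (hT : Icc (-1) T ⊆ maxInterval f φ) :
    (∀ᶠ n in atTop, Icc (-1) T ⊆ maxInterval (fn n) (φn n)) ∧
      TendstoUniformlyOn (fun n => sol (fn n) (φn n)) (sol f φ) atTop (Icc (-1) T) := by
  have hmem : max T 0 ∈ maxInterval f φ := by
    rcases le_total T 0 with h | h
    · rw [max_eq_right h]
      exact zero_mem_maxInterval f φ
    · rw [max_eq_left h]
      exact hT ⟨by linarith, le_rfl⟩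
  have key : ∀ ε > (0 : ℝ), ∀ᶠ n in atTop, max T 0 ∈ maxInterval (fn n) (φn n) ∧
      ∀ t ∈ Icc (-1) (max T 0), ‖sol (fn n) (φn n) t - sol f φ t‖ ≤ ε := by
    intro ε hε
    obtain ⟨δ, hδ, hev⟩ :=
      exists_eventually_norm_sol_sub_le hE hKy hD (le_max_right T 0) hmem hε
    filter_upwards [hf.eventually hev, Metric.tendsto_nhds.1 hφ δ hδ] with n hn hn'
    exact hn (hfn n) _ hn'
  refine ⟨?_, Metric.tendstoUniformlyOn_iff.2 fun ε hε => ?_⟩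
  · filter_upwards [key 1 one_pos] with n hn t ht
    exact mem_maxInterval_of_le hn.1 ht.1 (ht.2.trans (le_max_left _ _))
  · filter_upwards [key (ε / 2) (half_pos hε)] with n hn t ht
    rw [dist_comm, dist_eq_norm]
    exact (hn.2 t ⟨ht.1, ht.2.trans (le_max_left _ _)⟩).trans_lt (half_lt_self hε)

/-! ### Continuity of the translations -/

theorem tendsto_zero_of_eventually_le_ofReal {α : Type*} {l : Filter α} {F : α → ℝ≥0∞}
    (h : ∀ ε > (0 : ℝ), ∀ᶠ a in l, F a ≤ ENNReal.ofReal ε) : Tendsto F l (𝓝 0) := by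
  rw [ENNReal.tendsto_nhds_zero]
  intro ε hε
  rcases eq_or_ne ε ⊤ with rfl | hε'
  · exact Eventually.of_forall fun _ => le_top
  · have := h ε.toReal (ENNReal.toReal_pos hε.ne' hε')
    rwa [ENNReal.ofReal_toReal hε'] at this

theorem setLIntegral_comp_add_left (G : ℝ → ℝ≥0∞) (s a b : ℝ) :
    ∫⁻ t in Icc a b, G (s + t) = ∫⁻ u in Icc (s + a) (s + b), G u := by
  have := (measurePreserving_add_left (volume : Measure ℝ) s).setLIntegral_comp_preimage_emb
    (measurableEmbedding_addLeft s) G (Icc (s + a) (s + b))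
  rw [← this, preimage_const_add_Icc, add_sub_cancel_left, add_sub_cancel_left]

/-- Translations are continuous in `L¹_loc`. -/
theorem tendsto_lintegral_translate_sub {F : Type*} [NormedAddCommGroup F] {h : ℝ → F}
    (hh : LocallyIntegrable h volume) (s a b : ℝ) :
    Tendsto (fun s' => ∫⁻ t in Icc a b, ‖h (s' + t) - h (s + t)‖ₑ) (𝓝 s) (𝓝 0) := by
  set J := Icc (a + s - 1) (b + s + 1) with hJ
  set H := J.indicator h with hH
  have hHL : MemLp H 1 volume := memLp_one_iff_integrable.2
    ((integrable_indicator_iff measurableSet_Icc).2 (hh.integrableOn_isCompact isCompact_Icc))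
  let tr : ℝ → C(ℝ, ℝ) := fun s => ⟨fun t => s + t, by fun_prop⟩
  have htr : Continuous tr := ContinuousMap.continuous_of_continuous_uncurry _ continuous_add
  have hmp : ∀ s, MeasurePreserving (tr s) volume volume := fun s =>
    measurePreserving_add_left volume s
  have h1 : Tendsto (fun s' => edist (Lp.compMeasurePreserving (tr s') (hmp s') (hHL.toLp H))
      (Lp.compMeasurePreserving (tr s) (hmp s) (hHL.toLp H))) (𝓝 s) (𝓝 0) := by
    have : Tendsto (fun s' => Lp.compMeasurePreserving (tr s') (hmp s') (hHL.toLp H)) (𝓝 s)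
        (𝓝 (Lp.compMeasurePreserving (tr s) (hmp s) (hHL.toLp H))) :=
      Filter.Tendsto.compMeasurePreservingLp tendsto_const_nhds (htr.tendsto s) hmp (hmp s)
        ENNReal.one_ne_top
    exact tendsto_iff_edist_tendsto_0.1 this
  refine tendsto_of_tendsto_of_tendsto_of_le_of_le' tendsto_const_nhds h1
    (Eventually.of_forall fun _ => zero_le) ?_
  filter_upwards [Metric.ball_mem_nhds s one_pos] with s' hs'
  rw [Lp.toLp_compMeasurePreserving, Lp.toLp_compMeasurePreserving, Lp.edist_toLp_toLp,
    eLpNorm_one_eq_lintegral_enorm]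
  refine le_trans (setLIntegral_mono' measurableSet_Icc fun t ht => ?_)
    (setLIntegral_le_lintegral (Icc a b) _)
  rw [Metric.mem_ball, Real.dist_eq, abs_lt] at hs'
  have m1 : s' + t ∈ J := ⟨by linarith [ht.1], by linarith [ht.2]⟩
  have m2 : s + t ∈ J := ⟨by linarith [ht.1], by linarith [ht.2]⟩
  have e1 : H (s' + t) = h (s' + t) := indicator_of_mem m1 h
  have e2 : H (s + t) = h (s + t) := indicator_of_mem m2 h
  change _ ≤ ‖H (s' + t) - H (s + t)‖ₑ
  rw [e1, e2]

/-- The orbit `s ↦ f_s` of a single function is continuous in the strong topology. Along a finite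
net of constants this is the continuity of the translations in `L¹_loc`, and the Lipschitz
continuity of `f` takes care of all other curves. -/
theorem tendsto_strongDist_translate (Θ : Moduli) (D : Set (V N)) (i : Idx D) (f : LC N) (s : ℝ) :
    Tendsto (fun s' => strongDist Θ D i (translate s' f) (translate s f)) (𝓝 s) (𝓝 0) := by
  obtain ⟨⟨⟨q₁, q₂⟩, hq⟩, ⟨y, hy⟩, j⟩ := i
  refine tendsto_zero_of_eventually_le_ofReal fun ε hε => ?_
  obtain ⟨l, hl, hl0, hlb⟩ := f.exists_lipschitz (max (j : ℝ) ‖y‖)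
  set J := Icc ((q₁ : ℝ) + s - 1) (q₂ + s + 1) with hJ
  set L := ∫ u in J, l u with hL
  have hlJ : IntegrableOn l J := hl.integrableOn_isCompact isCompact_Icc
  have hL0 : 0 ≤ L := integral_nonneg hl0
  have hLl : ∫⁻ u in J, ENNReal.ofReal (l u) = ENNReal.ofReal L :=
    (ofReal_integral_eq_lintegral_ofReal hlJ (Eventually.of_forall hl0)).symm
  set ε₀ : ℝ := ε / (4 * (L + 1)) with hε₀
  have hε₀0 : 0 < ε₀ := by positivity
  obtain ⟨F, hFsub, hFfin, hFcov⟩ :=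
    finite_cover_balls_of_compact (isCompact_closedBall (0 : V N) j) hε₀0
  lift F to Finset (V N) using hFfin
  have hsum : Tendsto (fun s' => ∑ a ∈ F, ∫⁻ t in Icc (q₁ : ℝ) q₂,
      ‖f (s' + t) a y - f (s + t) a y‖ₑ) (𝓝 s) (𝓝 0) := by
    have := tendsto_finsetSum F fun a _ =>
      tendsto_lintegral_translate_sub (f.locallyIntegrable_const a y) s (q₁ : ℝ) q₂
    simpa using this
  have hnear : ∀ᶠ s' in 𝓝 s, s' ∈ Metric.ball s 1 := Metric.ball_mem_nhds s one_pos
  filter_upwards [ENNReal.tendsto_nhds_zero.1 hsum (ENNReal.ofReal (ε / 2))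
    (ENNReal.ofReal_pos.2 (half_pos hε)), hnear] with s' hs' hs'1
  have hlI : ∀ r ∈ Metric.ball s 1, ∫⁻ t in Icc (q₁ : ℝ) q₂, ENNReal.ofReal (l (r + t)) ≤
      ENNReal.ofReal L := by
    intro r hr
    rw [Metric.mem_ball, Real.dist_eq, abs_lt] at hr
    rw [setLIntegral_comp_add_left (fun u => ENNReal.ofReal (l u)), ← hLl]
    exact lintegral_mono_set (Icc_subset_Icc (by linarith) (by linarith))
  have hmeasF : ∀ a ∈ F, AEMeasurable (fun t => ‖f (s' + t) a y - f (s + t) a y‖ₑ)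
      (volume.restrict (Icc (q₁ : ℝ) q₂)) := fun a _ =>
    ((((translate s' f).measurable_comp measurable_const measurable_const).sub
      ((translate s f).measurable_comp measurable_const measurable_const)).enorm).aemeasurable
  have hmeasl : ∀ r, AEMeasurable (fun t => ENNReal.ofReal (l (r + t)))
      (volume.restrict (Icc (q₁ : ℝ) q₂)) := fun r =>
    ((locallyIntegrable_translate hl r).aestronglyMeasurable.aemeasurable.ennreal_ofReal).restrict
  refine iSup₂_le fun x hx => ?_
  calc ∫⁻ t in Icc (q₁ : ℝ) q₂, ‖f (s' + t) (x t) y - f (s + t) (x t) y‖ₑ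
      ≤ ∫⁻ t in Icc (q₁ : ℝ) q₂, ((∑ a ∈ F, ‖f (s' + t) a y - f (s + t) a y‖ₑ) +
          (ENNReal.ofReal (l (s' + t)) * ENNReal.ofReal ε₀ +
            ENNReal.ofReal (l (s + t)) * ENNReal.ofReal ε₀)) := by
        refine lintegral_mono_ae ?_
        filter_upwards [ae_restrict_of_ae (ae_translate hlb s'),
          ae_restrict_of_ae (ae_translate hlb s), ae_restrict_mem measurableSet_Icc]
          with t ht' ht htI
        have hxj : ‖x t‖ ≤ j := hx.2.1 t htI
        obtain ⟨a, ha, hxa⟩ := mem_iUnion₂.1 (hFcov (show x t ∈ Metric.closedBall (0 : V N) j by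
          simpa using hxj))
        have haj : ‖a‖ ≤ j := by simpa using hFsub ha
        have hxa' : ‖x t - a‖ ≤ ε₀ := by
          rw [← dist_eq_norm]; exact (Metric.mem_ball.1 hxa).le
        have hlip : ∀ r, (∀ a b a' b' : V N, ‖a‖ ≤ max (j : ℝ) ‖y‖ → ‖b‖ ≤ max (j : ℝ) ‖y‖ →
            ‖a'‖ ≤ max (j : ℝ) ‖y‖ → ‖b'‖ ≤ max (j : ℝ) ‖y‖ →
            ‖f r a b - f r a' b'‖ ≤ l r * (‖a - a'‖ + ‖b - b'‖)) →
            ‖f r (x t) y - f r a y‖ₑ ≤ ENNReal.ofReal (l r) * ENNReal.ofReal ε₀ := by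
          intro r hr
          rw [← ofReal_norm, ← ENNReal.ofReal_mul (hl0 r)]
          refine ENNReal.ofReal_le_ofReal ((hr _ _ _ _ (hxj.trans (le_max_left _ _))
            (le_max_right _ _) (haj.trans (le_max_left _ _)) (le_max_right _ _)).trans ?_)
          rw [sub_self, norm_zero, add_zero]
          exact mul_le_mul_of_nonneg_left hxa' (hl0 r)
        have hdec : f (s' + t) (x t) y - f (s + t) (x t) y = (f (s' + t) a y - f (s + t) a y) +
            ((f (s' + t) (x t) y - f (s' + t) a y) - (f (s + t) (x t) y - f (s + t) a y)) := by
          abel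
        rw [hdec]
        refine (enorm_add_le _ _).trans (add_le_add ?_ ((enorm_sub_le).trans
          (add_le_add (hlip _ ht') (hlip _ ht))))
        exact Finset.single_le_sum (f := fun a => ‖f (s' + t) a y - f (s + t) a y‖ₑ)
          (fun _ _ => zero_le) ha
    _ = (∑ a ∈ F, ∫⁻ t in Icc (q₁ : ℝ) q₂, ‖f (s' + t) a y - f (s + t) a y‖ₑ) +
          ((∫⁻ t in Icc (q₁ : ℝ) q₂, ENNReal.ofReal (l (s' + t))) * ENNReal.ofReal ε₀ +
            (∫⁻ t in Icc (q₁ : ℝ) q₂, ENNReal.ofReal (l (s + t))) * ENNReal.ofReal ε₀) := by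
        rw [lintegral_add_left' (Finset.aemeasurable_fun_sum F hmeasF),
          lintegral_finsetSum' F hmeasF, lintegral_add_left' ((hmeasl s').mul_const _),
          lintegral_mul_const'' _ (hmeasl s'), lintegral_mul_const'' _ (hmeasl s)]
    _ ≤ ENNReal.ofReal (ε / 2) + (ENNReal.ofReal L * ENNReal.ofReal ε₀ +
          ENNReal.ofReal L * ENNReal.ofReal ε₀) := by
        gcongr
        · exact hlI s' hs'1
        · exact hlI s (Metric.mem_ball_self one_pos)
    _ ≤ ENNReal.ofReal ε := by
        rw [← ENNReal.ofReal_mul hL0, ← ENNReal.ofReal_add (by positivity) (by positivity),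
          ← ENNReal.ofReal_add (by positivity) (by positivity)]
        refine ENNReal.ofReal_le_ofReal ?_
        have : (L + 1) * ε₀ = ε / 4 := by rw [hε₀]; field_simp
        nlinarith

/-- For a translation invariant family the moduli do not depend on the interval. -/
theorem BaseInvariant.mBoundModuli_le {E : Set (LC N)} (hinv : BaseInvariant E) {q₁ q₂ p₁ p₂ : ℚ}
    (hp : p₁ ≤ p₂) (j : ℕ) {s s' : ℝ} (hs : s ≤ s') :
    mBoundModuli E q₁ q₂ j s ≤ mBoundModuli E p₁ p₂ j s' := by
  refine iSup₂_le fun t ht => iSup₂_le fun f hf => ?_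
  have hp₁ : (p₁ : ℝ) ∈ Icc (p₁ : ℝ) p₂ := ⟨le_rfl, by exact_mod_cast hp⟩
  refine le_trans ?_ (lintegral_optMBound_le_mBoundModuli (hinv f hf (t - p₁)) j hp₁ s')
  have h1 : ∫⁻ u in Icc (p₁ : ℝ) (p₁ + s'), optMBound (translate (t - p₁) f) j u =
      ∫⁻ u in Icc t (t + s'), optMBound f j u := by
    have := setLIntegral_comp_add_left (optMBound f j) (t - p₁) (p₁ : ℝ) (p₁ + s')
    rw [sub_add_cancel, ← add_assoc, sub_add_cancel] at this
    exact this
  rw [h1]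
  exact lintegral_mono_set (Icc_subset_Icc le_rfl (by linarith))

/-- For a translation invariant family, translated test curves are test curves. -/
theorem BaseInvariant.comp_projIcc_mem_KSet {E : Set (LC N)} (hinv : BaseInvariant E)
    {q₁ q₂ p₁ p₂ : ℚ} (hq : (q₁ : ℝ) ≤ q₂) (hp : p₁ ≤ p₂) {j : ℕ} {x : ℝ → V N}
    (hx : x ∈ KSet N (mBoundModuli E) q₁ q₂ j) (s : ℝ) :
    (fun u => x (projIcc (q₁ : ℝ) q₂ hq (u - s))) ∈ KSet N (mBoundModuli E) p₁ p₂ j := by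
  refine ⟨(hx.1.comp_continuous (by fun_prop) fun u => Subtype.coe_prop _).continuousOn,
    fun t _ => hx.2.1 _ (Subtype.coe_prop _), fun t _ r _ => ?_⟩
  refine (hx.2.2 _ (Subtype.coe_prop _) _ (Subtype.coe_prop _)).trans
    (hinv.mBoundModuli_le hp j ?_)
  refine (abs_projIcc_sub_projIcc hq).trans (le_of_eq ?_)
  congr 1
  ring

/-- A rational interval that contains `s' + [q₁, q₂]` for all `s'` close to `s`, but is not much
longer. -/
theorem exists_rat_interval (q₁ q₂ : ℚ) (hq : q₁ < q₂) (s : ℝ) {δ : ℝ} (hδ : 0 < δ) :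
    ∃ p₁ p₂ : ℚ, p₁ < p₂ ∧ ∀ᶠ s' in 𝓝 s, (p₁ : ℝ) ≤ s' + q₁ ∧ s' + q₁ - p₁ < δ ∧
      s' + q₂ ≤ p₂ ∧ p₂ - (s' + q₂) < δ := by
  obtain ⟨p₁, h₁, h₁'⟩ := exists_rat_btwn (show s + q₁ - δ / 2 < s + q₁ - δ / 4 by linarith)
  obtain ⟨p₂, h₂, h₂'⟩ := exists_rat_btwn (show s + q₂ + δ / 4 < s + q₂ + δ / 2 by linarith)
  have hq' : (q₁ : ℝ) < q₂ := by exact_mod_cast hq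
  refine ⟨p₁, p₂, by exact_mod_cast (by linarith : (p₁ : ℝ) < p₂), ?_⟩
  filter_upwards [Metric.ball_mem_nhds s (show 0 < δ / 4 by positivity)] with s' hs'
  rw [Metric.mem_ball, Real.dist_eq, abs_lt] at hs'
  exact ⟨by linarith, by linarith, by linarith, by linarith⟩

/-- Simultaneous translation, weak seminorms. The integral over `s' + I` is compared with that over a
fixed rational interval; the two short intervals left over are dealt with by the `m`-bounds of `E`,
which is why `g` has to belong to `E`. -/
theorem eventually_weakDist_translate_le {E : Set (LC N)} (hE : HasL1LocEquicontinuousMBounds E)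
    (hinv : BaseInvariant E) (D : Set (V N)) (i : Idx D) (f : LC N) (s : ℝ) {ε : ℝ}
    (hε : 0 < ε) :
    ∀ᶠ p in 𝓝 s ×ˢ @nhds _ (sigmaTop (mBoundModuli E) D) f, p.2 ∈ E →
      weakDist (mBoundModuli E) D i (translate p.1 p.2) (translate p.1 f) ≤ ENNReal.ofReal ε := by
  obtain ⟨⟨⟨q₁, q₂⟩, hq⟩, ⟨y, hy⟩, j⟩ := i
  have hq' : (q₁ : ℝ) ≤ q₂ := by exact_mod_cast hq.le
  set T : ℝ := |(q₁ : ℝ)| + |(q₂ : ℝ)| + |s| + 2 with hT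
  obtain ⟨δg, hδg, hg⟩ := hE.exists_norm_integral_le (max (j : ℝ) ‖y‖) T (ε := ε / 8) (by positivity)
  obtain ⟨δf, hδf, hf⟩ := (hasL1LocEquicontinuousMBounds_singleton f).exists_norm_integral_le
    (max (j : ℝ) ‖y‖) T (ε := ε / 8) (by positivity)
  obtain ⟨p₁, p₂, hp, hev⟩ := exists_rat_interval q₁ q₂ hq s (lt_min (lt_min hδg hδf) one_pos)
  have hnear : ∀ᶠ s' in 𝓝 s, s' ∈ Metric.ball s 1 := Metric.ball_mem_nhds s one_pos
  filter_upwards [(hev.and hnear).prod_mk (eventually_weakDist_lt (mBoundModuli E) D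
    ⟨⟨(p₁, p₂), hp⟩, ⟨y, hy⟩, j⟩ f (ENNReal.ofReal_pos.2 (half_pos hε)))]
  rintro ⟨s', g⟩ ⟨⟨⟨h₁, h₁', h₂, h₂'⟩, hs'⟩, hw⟩ hgE
  dsimp only at h₁ h₁' h₂ h₂' hs' hw hgE ⊢
  rw [Metric.mem_ball, Real.dist_eq, abs_lt] at hs'
  refine iSup₂_le fun x hx => ?_
  dsimp only at hx ⊢
  set z : ℝ → V N := fun u => x (projIcc (q₁ : ℝ) q₂ hq' (u - s')) with hz
  have hzK : z ∈ KSet N (mBoundModuli E) p₁ p₂ j := hinv.comp_projIcc_mem_KSet hq' hp.le hx s'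
  have hmain := norm_integral_sub_le_of_weakDist_lt (half_pos hε).le hw hzK
  dsimp only at hmain
  have hzc : ContinuousOn z (Icc p₁ p₂) := hzK.1
  have hzR : ∀ u, ‖z u‖ ≤ max (j : ℝ) ‖y‖ := fun u =>
    (hx.2.1 _ (Subtype.coe_prop _)).trans (le_max_left _ _)
  have hint : ∀ k : LC N, ∀ a b, (p₁ : ℝ) ≤ a → a ≤ b → b ≤ p₂ →
      IntervalIntegrable (fun u => k u (z u) y) volume a b := fun k a b ha hab hb =>
    k.intervalIntegrable hab (hzc.mono (Icc_subset_Icc ha hb)) continuousOn_const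
  have hsub : ∀ a b, (p₁ : ℝ) ≤ a → a ≤ b → b ≤ p₂ →
      IntervalIntegrable (fun u => g u (z u) y - f u (z u) y) volume a b :=
    fun a b ha hab hb => (hint g a b ha hab hb).sub (hint f a b ha hab hb)
  have hδ1 : min (min δg δf) 1 ≤ 1 := min_le_right _ _
  have hδg' : min (min δg δf) 1 ≤ δg := (min_le_left _ _).trans (min_le_left _ _)
  have hδf' : min (min δg δf) 1 ≤ δf := (min_le_left _ _).trans (min_le_right _ _)
  have hp₁T : -T ≤ p₁ := by
    linarith [neg_abs_le (q₁ : ℝ), abs_nonneg (q₂ : ℝ), neg_abs_le s]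
  have hp₂T : (p₂ : ℝ) ≤ T := by
    linarith [le_abs_self (q₂ : ℝ), abs_nonneg (q₁ : ℝ), le_abs_self s]
  have hmid : s' + (q₁ : ℝ) ≤ s' + q₂ := by linarith
  have hsmall : ∀ a b, (p₁ : ℝ) ≤ a → a ≤ b → b ≤ p₂ → b - a < min (min δg δf) 1 →
      ‖∫ u in a..b, (g u (z u) y - f u (z u) y)‖ ≤ ε / 4 := by
    intro a b ha hab hb hd
    rw [intervalIntegral.integral_sub (hint g a b ha hab hb) (hint f a b ha hab hb)]
    have e1 := hg g hgE z (fun _ => y) a b (by linarith) hab (by linarith) (by linarith)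
      (fun r _ => hzR r) (fun _ _ => le_max_right _ _)
    have e2 := hf f rfl z (fun _ => y) a b (by linarith) hab (by linarith) (by linarith)
      (fun r _ => hzR r) (fun _ _ => le_max_right _ _)
    linarith [norm_sub_le (∫ u in a..b, g u (z u) y) (∫ u in a..b, f u (z u) y)]
  have e1 := hsmall p₁ (s' + q₁) le_rfl h₁ (by linarith) h₁'
  have e2 := hsmall (s' + q₂) p₂ (by linarith) h₂ le_rfl h₂'
  have hcv : ∫ t in Icc (q₁ : ℝ) q₂, ((translate s' g) t (x t) y - (translate s' f) t (x t) y) =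
      ∫ u in (s' + (q₁ : ℝ))..(s' + q₂), (g u (z u) y - f u (z u) y) := by
    rw [integral_Icc_eq_integral_Ioc, ← intervalIntegral.integral_of_le hq',
      ← intervalIntegral.integral_comp_add_left (fun u => g u (z u) y - f u (z u) y) s']
    refine intervalIntegral.integral_congr fun t ht => ?_
    rw [uIcc_of_le hq'] at ht
    simp only [hz, add_sub_cancel_left, projIcc_of_mem hq' ht, translate]
  rw [hcv, ← ofReal_norm]
  refine ENNReal.ofReal_le_ofReal ?_
  have hsplit : ∫ u in (s' + (q₁ : ℝ))..(s' + q₂), (g u (z u) y - f u (z u) y) =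
      (∫ u in (p₁ : ℝ)..p₂, (g u (z u) y - f u (z u) y)) -
        (∫ u in (p₁ : ℝ)..(s' + q₁), (g u (z u) y - f u (z u) y)) -
        ∫ u in (s' + (q₂ : ℝ))..p₂, (g u (z u) y - f u (z u) y) := by
    rw [← intervalIntegral.integral_add_adjacent_intervals (hsub p₁ (s' + q₁) le_rfl h₁
        (by linarith)) (hsub (s' + q₁) p₂ h₁ (by linarith) le_rfl),
      ← intervalIntegral.integral_add_adjacent_intervals (hsub (s' + q₁) (s' + q₂) h₁ hmid h₂)
        (hsub (s' + q₂) p₂ (by linarith) h₂ le_rfl)]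
    abel
  rw [hsplit]
  refine (norm_sub_le _ _).trans ((add_le_add_left (norm_sub_le _ _) _).trans ?_)
  linarith

/-- Simultaneous translation, strong seminorms: here the integral is monotone in the interval. -/
theorem eventually_strongDist_translate_le {E : Set (LC N)}
    (hinv : BaseInvariant E) (D : Set (V N)) (i : Idx D) (f : LC N) (s : ℝ) {ε : ℝ}
    (hε : 0 < ε) :
    ∀ᶠ p in 𝓝 s ×ˢ @nhds _ (strongTop (mBoundModuli E) D) f,
      strongDist (mBoundModuli E) D i (translate p.1 p.2) (translate p.1 f) ≤
        ENNReal.ofReal ε := by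
  obtain ⟨⟨⟨q₁, q₂⟩, hq⟩, ⟨y, hy⟩, j⟩ := i
  have hq' : (q₁ : ℝ) ≤ q₂ := by exact_mod_cast hq.le
  obtain ⟨p₁, p₂, hp, hev⟩ := exists_rat_interval q₁ q₂ hq s one_pos
  filter_upwards [hev.prod_mk (eventually_strongDist_lt (mBoundModuli E) D
    ⟨⟨(p₁, p₂), hp⟩, ⟨y, hy⟩, j⟩ f (ENNReal.ofReal_pos.2 hε))]
  rintro ⟨s', g⟩ ⟨⟨h₁, h₁', h₂, h₂'⟩, hw⟩
  dsimp only at h₁ h₁' h₂ h₂' hw ⊢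
  refine iSup₂_le fun x hx => ?_
  dsimp only at hx ⊢
  set z : ℝ → V N := fun u => x (projIcc (q₁ : ℝ) q₂ hq' (u - s')) with hz
  have hzK : z ∈ KSet N (mBoundModuli E) p₁ p₂ j := hinv.comp_projIcc_mem_KSet hq' hp.le hx s'
  have hcv : ∫⁻ t in Icc (q₁ : ℝ) q₂,
      ‖(translate s' g) t (x t) y - (translate s' f) t (x t) y‖ₑ =
      ∫⁻ u in Icc (s' + (q₁ : ℝ)) (s' + q₂), ‖g u (z u) y - f u (z u) y‖ₑ := by
    rw [← setLIntegral_comp_add_left (fun u => ‖g u (z u) y - f u (z u) y‖ₑ)]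
    refine setLIntegral_congr_fun measurableSet_Icc fun t ht => ?_
    simp only [hz, add_sub_cancel_left, projIcc_of_mem hq' ht, translate]
  rw [hcv]
  exact (lintegral_mono_set (Icc_subset_Icc h₁ h₂)).trans
    ((le_iSup₂_of_le z hzK le_rfl).trans hw.le)

/-! ### The skew-product semiflow on the closure -/

/-- If the translations are jointly continuous along `E`, then they are so along the closure
of `E`. -/
theorem continuousOn_translate_closure {ι : Type} {d : ι → LC N → LC N → ℝ≥0∞}
    (hcomm : ∀ i f g, d i f g = d i g f) (htri : ∀ i f g h, d i f h ≤ d i f g + d i g h)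
    {τ : TopologicalSpace (LC N)} (hτ : τ = ⨅ (i : ι) (f : LC N), TopologicalSpace.induced
      (fun g : LC N => d i g f) inferInstance) {E : Set (LC N)}
    (h : ∀ i f s, ∀ ε > (0 : ℝ), ∀ᶠ p in 𝓝 s ×ˢ 𝓝 f, p.2 ∈ E →
      d i (translate p.1 p.2) (translate s f) ≤ ENNReal.ofReal ε) :
    ContinuousOn (fun q : ℝ × LC N => translate q.1 q.2) (univ ×ˢ closure E) := by
  rintro ⟨s, f⟩ -
  rw [ContinuousWithinAt, hτ]
  refine tendsto_nhds_of_dist hcomm htri fun i => ?_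
  rw [← hτ]
  refine tendsto_zero_of_eventually_le_ofReal fun ε hε => ?_
  have h1 := h i f s (ε / 2) (half_pos hε)
  rw [← nhds_prod_eq] at h1
  filter_upwards [mem_nhdsWithin_of_mem_nhds h1.eventually_nhds, self_mem_nhdsWithin]
  rintro ⟨s', g⟩ hp ⟨-, hg⟩
  have h2 := h i g s' (ε / 2) (half_pos hε)
  rw [← nhds_prod_eq] at h2
  have h3 : Tendsto (fun k : LC N => (s', k)) (𝓝 g) (𝓝 (s', g)) :=
    (Continuous.prodMk_right s').tendsto g
  -- some `k ∈ E` close to `g` is such that `k_{s'}` is close to both `g_{s'}` and `f_s`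
  obtain ⟨k, hkE, hk1, hk2⟩ := ((mem_closure_iff_frequently.1 hg).and_eventually
    (h3.eventually (hp.and h2))).exists
  refine (htri i _ (translate s' k) _).trans ?_
  rw [hcomm i (translate s' g)]
  refine (add_le_add (hk2 hkE) (hk1 hkE)).trans (le_of_eq ?_)
  rw [← ENNReal.ofReal_add (by positivity) (by positivity), add_halves]

theorem continuousOn_translate_sigmaTop {E : Set (LC N)} (hE : HasL1LocEquicontinuousMBounds E)
    (hinv : BaseInvariant E) (D : Set (V N)) {τ : TopologicalSpace (LC N)}
    (hτ : τ = sigmaTop (mBoundModuli E) D) :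
    ContinuousOn (fun q : ℝ × LC N => translate q.1 q.2) (univ ×ˢ closure E) := by
  refine continuousOn_translate_closure (weakDist_comm (mBoundModuli E) D)
    (weakDist_triangle (mBoundModuli E) D) hτ fun i f s ε hε => ?_
  subst hτ
  have h1 : ∀ᶠ s' in 𝓝 s, strongDist (mBoundModuli E) D i (translate s' f) (translate s f) ≤
      ENNReal.ofReal (ε / 2) := ENNReal.tendsto_nhds_zero.1
    (tendsto_strongDist_translate _ D i f s) _ (ENNReal.ofReal_pos.2 (half_pos hε))
  filter_upwards [eventually_weakDist_translate_le hE hinv D i f s (half_pos hε),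
    tendsto_fst.eventually h1] with p hp hp1 hpE
  refine (weakDist_triangle _ D i _ (translate p.1 f) _).trans ((add_le_add (hp hpE)
    ((weakDist_le_strongDist _ D i _ _).trans hp1)).trans (le_of_eq ?_))
  rw [← ENNReal.ofReal_add (by positivity) (by positivity), add_halves]

theorem continuousOn_translate_strongTop {E : Set (LC N)}
    (hinv : BaseInvariant E) (D : Set (V N)) {τ : TopologicalSpace (LC N)}
    (hτ : τ = strongTop (mBoundModuli E) D) :
    ContinuousOn (fun q : ℝ × LC N => translate q.1 q.2) (univ ×ˢ closure E) := by
  refine continuousOn_translate_closure (strongDist_comm (mBoundModuli E) D)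
    (strongDist_triangle (mBoundModuli E) D) hτ fun i f s ε hε => ?_
  subst hτ
  have h1 : ∀ᶠ s' in 𝓝 s, strongDist (mBoundModuli E) D i (translate s' f) (translate s f) ≤
      ENNReal.ofReal (ε / 2) := ENNReal.tendsto_nhds_zero.1
    (tendsto_strongDist_translate _ D i f s) _ (ENNReal.ofReal_pos.2 (half_pos hε))
  filter_upwards [eventually_strongDist_translate_le hinv D i f s (half_pos hε),
    tendsto_fst.eventually h1] with p hp hp1 _
  refine (strongDist_triangle _ D i _ (translate p.1 f) _).trans ((add_le_add hp hp1).trans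
    (le_of_eq ?_))
  rw [← ENNReal.ofReal_add (by positivity) (by positivity), add_halves]

theorem baseInvariant_closure {E : Set (LC N)} (hinv : BaseInvariant E)
    {τ : TopologicalSpace (LC N)}
    (hcont : ContinuousOn (fun q : ℝ × LC N => translate q.1 q.2) (univ ×ˢ closure E)) :
    BaseInvariant (closure E) := by
  intro f hf s
  have h1 : ContinuousWithinAt (translate s) E f :=
    (hcont (s, f) ⟨mem_univ _, hf⟩).comp (f := fun g : LC N => (s, g))
      (Continuous.prodMk_right s).continuousWithinAt fun g hg => ⟨mem_univ _, subset_closure hg⟩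
  exact h1.mem_closure hf fun g hg => hinv g hg s

theorem translate_zero (f : LC N) : translate 0 f = f := by
  ext1
  simp [translate]

theorem translate_add (s t : ℝ) (f : LC N) : translate (s + t) f = translate t (translate s f) := by
  ext1
  simp [translate, add_assoc]

/-- On the closure of `E`, a topology that is finer than the weak one and for which the translations
are continuous yields a continuous skew-product semiflow. -/
theorem isContinuousSkewProductSemiflow_closure {E : Set (LC N)}
    (hE : HasL1LocEquicontinuousMBounds E) (hKy : ∀ f ∈ E, Ky f) (hinv : BaseInvariant E)
    {D : Set (V N)} (hD : Dense D) {τ : TopologicalSpace (LC N)}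
    (hτ : ∀ f, @nhds _ τ f ≤ @nhds _ (sigmaTop (mBoundModuli E) D) f)
    (hcont : ContinuousOn (fun q : ℝ × LC N => translate q.1 q.2) (univ ×ˢ closure E)) :
    IsContinuousSkewProductSemiflow τ (closure E) := by
  have hinv' := baseInvariant_closure hinv hcont
  -- a time `T` beyond `p.1` is reached by all nearby solutions, uniformly on `[-1, T]`
  have hloc : ∀ p ∈ semiflowDomain (closure E), ∃ T, p.1 < T ∧ T ∈ maxInterval p.2.1 p.2.2 ∧
      ∀ ε > (0 : ℝ), ∀ᶠ q in 𝓝 p, q.2.1 ∈ closure E → q.1 < T ∧ T ∈ maxInterval q.2.1 q.2.2 ∧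
        ∀ t ∈ Icc (-1) T, ‖sol q.2.1 q.2.2 t - sol p.2.1 p.2.2 t‖ ≤ ε := by
    rintro ⟨t, f, φ⟩ ⟨ht, hf, htI⟩
    dsimp only at ht hf htI
    obtain ⟨δ₀, hδ₀, hT⟩ := exists_add_mem_maxInterval ht htI
    refine ⟨t + δ₀, lt_add_of_pos_right t hδ₀, hT, fun ε hε => ?_⟩
    obtain ⟨δ, hδ, hev⟩ := exists_eventually_closure_norm_sol_sub_le hE hKy hD hτ
      (show 0 ≤ t + δ₀ by linarith) hT hε
    have h1 : ∀ᶠ s in 𝓝 t, s < t + δ₀ := gt_mem_nhds (lt_add_of_pos_right t hδ₀)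
    have h2 : ∀ᶠ ψ in 𝓝 φ, dist ψ φ < δ := Metric.ball_mem_nhds φ hδ
    rw [nhds_prod_eq, nhds_prod_eq]
    filter_upwards [h1.prod_mk (hev.prod_mk h2)] with q hq hqE
    exact ⟨hq.1, hq.2.1 hqE _ hq.2.2⟩
  refine ⟨hinv', hcont, fun p hp => ⟨hinv' _ hp.2.1 _, mem_univ _⟩, fun f hf φ =>
    ⟨⟨le_rfl, hf, zero_mem_maxInterval f φ⟩, ?_⟩, fun s t hs ht f hf φ => ⟨⟨?_, ?_⟩, ?_⟩, ?_, ?_⟩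
  · simp only [skewMap, translate_zero, segment_zero]
  · rintro ⟨-, -, hst⟩
    have hs' := mem_maxInterval_of_le hst (show -1 ≤ s by linarith) (le_add_of_nonneg_right ht)
    exact ⟨⟨hs, hf, hs'⟩, ht, hinv' f hf s, (add_mem_maxInterval_iff hs ht hs').1 hst⟩
  · rintro ⟨⟨-, -, hs'⟩, -, -, ht'⟩
    exact ⟨add_nonneg hs ht, hf, (add_mem_maxInterval_iff hs ht hs').2 ht'⟩
  · rintro ⟨-, -, hst⟩
    simp only [skewMap]
    rw [translate_add, segment_add hs ht hst]
  · refine ⟨⋃₀ {O | IsOpen O ∧ O ∩ (Ici 0 ×ˢ closure E ×ˢ univ) ⊆ semiflowDomain (closure E)},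
      isOpen_sUnion fun O hO => hO.1, subset_antisymm (fun p hp => ?_) ?_⟩
    · obtain ⟨T, -, -, hev⟩ := hloc p hp
      obtain ⟨O, hOsub, hO, hpO⟩ := mem_nhds_iff.1 (hev 1 one_pos)
      refine ⟨⟨O, ⟨hO, ?_⟩, hpO⟩, hp.1, hp.2.1, mem_univ _⟩
      rintro q ⟨hqO, hq0, hqE, -⟩
      have hq := hOsub hqO hqE
      have hq0 : 0 ≤ q.1 := hq0
      exact ⟨hq0, hqE, mem_maxInterval_of_le hq.2.1 (by linarith) hq.1.le⟩
    · rintro p ⟨⟨O, hO, hpO⟩, hp⟩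
      exact hO.2 ⟨hpO, hp⟩
  · intro p hp
    refine ContinuousWithinAt.prodMk ?_ ?_
    · exact (hcont (p.1, p.2.1) ⟨mem_univ _, hp.2.1⟩).comp
        (f := fun q : ℝ × LC N × Hist N => (q.1, q.2.1))
        (by fun_prop : Continuous _).continuousWithinAt fun q hq => ⟨mem_univ _, hq.2.1⟩
    · obtain ⟨T, hpT, hTI, hev⟩ := hloc p hp
      have hp0 : 0 ≤ p.1 := hp.1
      have hT0 : 0 ≤ T := hp0.trans hpT.le
      have huc := isCompact_Icc.uniformContinuousOn_of_continuous
        ((mem_maxInterval_iff hT0).1 hTI).1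
      refine Metric.tendsto_nhds.2 fun ε hε => ?_
      obtain ⟨η, hη, hη'⟩ := Metric.uniformContinuousOn_iff.1 huc (ε / 4) (by positivity)
      have hclose : ∀ᶠ q : ℝ × LC N × Hist N in 𝓝 p, dist q.1 p.1 < η :=
        (continuous_fst.tendsto p).eventually (Metric.ball_mem_nhds p.1 hη)
      filter_upwards [self_mem_nhdsWithin, mem_nhdsWithin_of_mem_nhds (hev (ε / 4)
        (by positivity)), mem_nhdsWithin_of_mem_nhds hclose] with q hq hqev hqη
      obtain ⟨hqT, hqI, hqs⟩ := hqev hq.2.1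
      have hq0 : 0 ≤ q.1 := hq.1
      refine lt_of_le_of_lt ((ContinuousMap.dist_le (half_pos hε).le).2 fun r => ?_)
        (half_lt_self hε)
      rw [segment_apply hq0 hq.2.2, segment_apply hp0 hp.2.2]
      have m1 : q.1 + r ∈ Icc (-1) T := ⟨by linarith [r.2.1], by linarith [r.2.2]⟩
      have m2 : p.1 + r ∈ Icc (-1) T := ⟨by linarith [r.2.1], by linarith [r.2.2]⟩
      have e1 := hqs _ m1
      have e2 := hη' _ m1 _ m2 (by simpa using hqη)
      rw [← dist_eq_norm] at e1
      linarith [dist_triangle (sol q.2.1 q.2.2 (q.1 + r)) (sol p.2.1 p.2.2 (q.1 + r))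
        (sol p.2.1 p.2.2 (p.1 + r))]

end CarDelay

end

theorem theorem3p5 {N : ℕ} (E : Set (CarDelay.LC N))
    (hE : CarDelay.HasL1LocEquicontinuousMBounds E)
    (hKy : ∀ f ∈ E, CarDelay.Ky f)
    (D : Set (CarDelay.V N)) (hDc : D.Countable) (hDd : Dense D) :
    (∀ (φ : CarDelay.Hist N) (φn : ℕ → CarDelay.Hist N)
        (f : CarDelay.LC N) (fn : ℕ → CarDelay.LC N),
      Tendsto φn atTop (𝓝 φ) →
      (∀ n, fn n ∈ E) →
      Tendsto fn atTop (@nhds _ (CarDelay.sigmaTop (CarDelay.mBoundModuli E) D) f) →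
      ∀ T : ℝ, Icc (-1) T ⊆ CarDelay.maxInterval f φ →
        (∀ᶠ n in atTop, Icc (-1) T ⊆ CarDelay.maxInterval (fn n) (φn n)) ∧
        TendstoUniformlyOn (fun n => CarDelay.sol (fn n) (φn n)) (CarDelay.sol f φ) atTop
          (Icc (-1) T)) ∧
    (CarDelay.BaseInvariant E →
      ∀ τ : TopologicalSpace (CarDelay.LC N),
        (τ = CarDelay.sigmaTop (CarDelay.mBoundModuli E) D ∨
          τ = CarDelay.strongTop (CarDelay.mBoundModuli E) D) →
        CarDelay.IsContinuousSkewProductSemiflow τ (@closure _ τ E)) := by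
  refine ⟨fun φ φn f fn hφ hfn hf T hT =>
    CarDelay.tendstoUniformlyOn_sol hE hKy hDd hφ hfn hf hT, fun hinv τ hτ => ?_⟩
  rcases hτ with rfl | rfl
  · exact CarDelay.isContinuousSkewProductSemiflow_closure hE hKy hinv hDd (fun _ => le_rfl)
      (CarDelay.continuousOn_translate_sigmaTop hE hinv D rfl)
  · exact CarDelay.isContinuousSkewProductSemiflow_closure hE hKy hinv hDd
      (CarDelay.nhds_strongTop_le _ D) (CarDelay.continuousOn_translate_strongTop hinv D rfl)
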